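/- Let $U\subseteq\mathbb R^2$ be open and let $B^a_{bc}=B^a_{cb}$ ($a,b,c\in\{2,3\}$) be smooth real functions of $(y,z)\in U$. Consider the autonomous system of two quadratically semi-linear ODEs $$y''+B^2_{22}y'^2+2B^2_{23}y'z'+B^2_{33}z'^2=0,\qquad z''+B^3_{22}y'^2+2B^3_{23}y'z'+B^3_{33}z'^2=0,$$ where the prime denotes differentiation with respect to the independent variable $x$. This system is linearizable by point transformations to the simplest (free-particle) system if and only if on $U$ the coefficients satisfy the four conditions (subscripts $y$, $z$ after the indices denote partial derivatives) $$\begin{aligned} -B^3_{22}B^3_{33}+B^3_{23,y}-B^3_{22,z}+B^3_{22}B^2_{23}+B^3_{23}B^3_{23}-B^3_{23}B^2_{22}&=0,\\ \tfrac43B^3_{33,y}-\tfrac43B^3_{23,z}+2B^3_{22}B^2_{33}-2B^3_{23}B^2_{23}-\tfrac23B^2_{23,y}+\tfrac23B^2_{22,z}&=0,\\ -\tfrac13B^3_{23,z}+B^2_{33}B^3_{22}-B^2_{23}B^3_{23}-\tfrac23B^2_{23,y}+\tfrac13B^3_{33,y}+\tfrac23B^2_{22,z}&=0,\\ -B^2_{33,y}+B^2_{23,z}-B^2_{22}B^2_{33}+B^2_{23}B^2_{23}-B^2_{23}B^3_{33}+B^2_{33}B^3_{23}&=0.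 \end{aligned}$$ Here linearizable means: every point of $\mathbb R\times U$ has an open neighbourhood on which there is a point transformation, that is, a diffeomorphism $(x,y,z)\mapsto(u,v,w)$ onto an open subset of $\mathbb R^3$ (smooth with smooth inverse), that carries the system into $v''=0$, $w''=0$ with prime $=d/du$; that is, whenever it maps the graph of a $C^2$ curve $x\mapsto(y(x),z(x))$ over an open interval onto the graph of a $C^2$ curve $u\mapsto(v(u),w(u))$ over an open interval, the former is a solution of the given system if and only if the latter is a solution of $v''=0$, $w''=0$. Moreover, at each point of $U$ the four conditions are equivalent to the flatness conditions $$a_z-b_y+be-cd=0,\quad b_z-c_y+(ac-b^2)+(bf-ce)=0,\quad d_z-e_y-(ae-bd)-(df-e^2)=0,\quad (b+f)_y=(a+e)_z,$$ where $a=-B^2_{22}$, $b=-B^2_{23}$, $c=-B^2_{33}$, $d=-B^3_{22}$, $e=-B^3_{23}$, $f=-B^3_{33}$, and also to the vanishing of the Riemann tensor $R^i_{\,jkl}=\Gamma^i_{jl,k}-\Gamma^i_{jk,l}+\Gamma^i_{mk}\Gamma^m_{jl}-\Gamma^i_{ml}\Gamma^m_{jk}$ of the symmetric connection $\Gamma^a_{bc}=B^a_{bc}$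 in the variables $(y,z)$. -/

import Mathlib

open scoped ContDiff

namespace QuadLin

/-! ### Systems of two second-order ODEs and point transformations

Points of the space of independent and dependent variables are triples `(x, y, z)`. -/

/-- A system `y'' = F(x, y, z, y', z')`, `z'' = G(x, y, z, y', z')` of two second-order ODEs
over a region `domain` of `(x, y, z)`-space. -/
structure System where
  /-- the region of `(x, y, z)`-space on which the system is given -/
  domain : Set (ℝ × ℝ × ℝ)
  /-- the right-hand side of the equation for `y''` -/
  F : ℝ → ℝ → ℝ → ℝ → ℝ → ℝ
  /-- the right-hand side of the equation for `z''` -/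
  G : ℝ → ℝ → ℝ → ℝ → ℝ → ℝ

/-- `x ↦ (y x, z x)` is a (twice differentiable) solution of the system on the open set `I`. -/
def System.IsSolutionOn (S : System) (I : Set ℝ) (y z : ℝ → ℝ) : Prop :=
  ∃ y₁ z₁ : ℝ → ℝ, ∀ x ∈ I,
    (x, y x, z x) ∈ S.domain ∧
    HasDerivAt y (y₁ x) x ∧ HasDerivAt z (z₁ x) x ∧
    HasDerivAt y₁ (S.F x (y x) (z x) (y₁ x) (z₁ x)) x ∧
    HasDerivAt z₁ (S.G x (y x) (z x) (y₁ x) (z₁ x)) x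

/-- The simplest (free-particle) system `y'' = 0`, `z'' = 0`. -/
def freeParticle : System where
  domain := Set.univ
  F _ _ _ _ _ := 0
  G _ _ _ _ _ := 0

/-- The graph of `x ↦ (y x, z x)` over `I`, a curve in `(x, y, z)`-space. -/
def graphOver (I : Set ℝ) (y z : ℝ → ℝ) : Set (ℝ × ℝ × ℝ) :=
  (fun x => (x, y x, z x)) '' I

/-- A (local) point transformation: a smooth invertible change
`(x, y, z) ↦ (u, v, w)` of the independent and the dependent variables, with smooth inverse,
between two open subsets of `ℝ³`. -/
def IsPointTransformation (Φ : OpenPartialHomeomorph (ℝ × ℝ × ℝ) (ℝ × ℝ × ℝ)) : Prop :=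
  ContDiffOn ℝ ∞ Φ Φ.source ∧ ContDiffOn ℝ ∞ Φ.symm Φ.target

/-- `Φ` carries the system `S` into the system `T`: whenever `Φ` maps the graph of a `C²` curve
`x ↦ (y x, z x)` in its source onto the graph of a `C²` curve `u ↦ (v u, w u)`, the first curve is
a solution of `S` if and only if the second one is a solution of `T`. -/
def Transforms (Φ : OpenPartialHomeomorph (ℝ × ℝ × ℝ) (ℝ × ℝ × ℝ)) (S T : System) : Prop :=
  Φ.source ⊆ S.domain ∧ Φ.target ⊆ T.domain ∧
  ∀ (I J : Set ℝ) (y z v w : ℝ → ℝ),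
    IsOpen I → I.OrdConnected → IsOpen J → J.OrdConnected →
    ContDiffOn ℝ 2 y I → ContDiffOn ℝ 2 z I → ContDiffOn ℝ 2 v J → ContDiffOn ℝ 2 w J →
    graphOver I y z ⊆ Φ.source → Φ '' graphOver I y z = graphOver J v w →
    (S.IsSolutionOn I y z ↔ T.IsSolutionOn J v w)

/-- `S` is linearizable to the free-particle system by point transformations: near every point of
its domain some point transformation carries it into the free-particle system. -/
def System.LinearizableToFreeParticle (S : System) : Prop :=
  ∀ p ∈ S.domain, ∃ Φ : OpenPartialHomeomorph (ℝ × ℝ × ℝ) (ℝ × ℝ × ℝ),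
    p ∈ Φ.source ∧ IsPointTransformation Φ ∧ Transforms Φ S freeParticle

/-! ### Autonomous quadratically semi-linear systems -/

/-- Six functions of `(y, z)`: the coefficients `Babc` stands for $B^a_{bc}$, `a, b, c ∈ {2, 3}`,
with `B^a_{bc}` symmetric in `b, c`; the index `2` belongs to `y` and the index `3` to `z`. -/
structure Coeffs where
  B222 : ℝ × ℝ → ℝ
  B223 : ℝ × ℝ → ℝ
  B233 : ℝ × ℝ → ℝ
  B322 : ℝ × ℝ → ℝ
  B323 : ℝ × ℝ → ℝ
  B333 : ℝ × ℝ → ℝ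

/-- The coefficients are smooth on `U`. -/
def Coeffs.SmoothOn (B : Coeffs) (U : Set (ℝ × ℝ)) : Prop :=
  ContDiffOn ℝ ∞ B.B222 U ∧ ContDiffOn ℝ ∞ B.B223 U ∧ ContDiffOn ℝ ∞ B.B233 U ∧
  ContDiffOn ℝ ∞ B.B322 U ∧ ContDiffOn ℝ ∞ B.B323 U ∧ ContDiffOn ℝ ∞ B.B333 U

/-- The system
`y'' + B²₂₂ y'² + 2 B²₂₃ y' z' + B²₃₃ z'² = 0`, `z'' + B³₂₂ y'² + 2 B³₂₃ y' z' + B³₃₃ z'² = 0`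
over `x ∈ ℝ`, `(y, z) ∈ U`. -/
def Coeffs.system (B : Coeffs) (U : Set (ℝ × ℝ)) : System where
  domain := {p | p.2 ∈ U}
  F _ y z y₁ z₁ :=
    -(B.B222 (y, z) * y₁ ^ 2 + 2 * B.B223 (y, z) * y₁ * z₁ + B.B233 (y, z) * z₁ ^ 2)
  G _ y z y₁ z₁ :=
    -(B.B322 (y, z) * y₁ ^ 2 + 2 * B.B323 (y, z) * y₁ * z₁ + B.B333 (y, z) * z₁ ^ 2)

/-- The partial derivative with respect to the first variable, `y`. -/
noncomputable def dy (f : ℝ × ℝ → ℝ) (p : ℝ × ℝ) : ℝ := fderiv ℝ f p (1, 0)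

/-- The partial derivative with respect to the second variable, `z`. -/
noncomputable def dz (f : ℝ × ℝ → ℝ) (p : ℝ × ℝ) : ℝ := fderiv ℝ f p (0, 1)

/-- The four conditions on the coefficients, at the point `p`. -/
def Coeffs.FourConditionsAt (B : Coeffs) (p : ℝ × ℝ) : Prop :=
  -B.B322 p * B.B333 p + dy B.B323 p - dz B.B322 p + B.B322 p * B.B223 p
      + B.B323 p * B.B323 p - B.B323 p * B.B222 p = 0 ∧
  4 / 3 * dy B.B333 p - 4 / 3 * dz B.B323 p + 2 * B.B322 p * B.B233 p
      - 2 * B.B323 p * B.B223 p - 2 / 3 * dy B.B223 p + 2 / 3 * dz B.B222 p = 0 ∧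
  -(1 / 3) * dz B.B323 p + B.B233 p * B.B322 p - B.B223 p * B.B323 p
      - 2 / 3 * dy B.B223 p + 1 / 3 * dy B.B333 p + 2 / 3 * dz B.B222 p = 0 ∧
  -dy B.B233 p + dz B.B223 p - B.B222 p * B.B233 p + B.B223 p * B.B223 p
      - B.B223 p * B.B333 p + B.B233 p * B.B323 p = 0

/-- The flatness conditions, at the point `p`, for the connection in the variables `(y, z)` whose
Christoffel symbols are `-a, -b, -c` (upper index `y`) and `-d, -e, -f` (upper index `z`). -/
def FlatnessConditionsAt (a b c d e f : ℝ × ℝ → ℝ) (p : ℝ × ℝ) : Prop :=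
  dz a p - dy b p + b p * e p - c p * d p = 0 ∧
  dz b p - dy c p + (a p * c p - b p ^ 2) + (b p * f p - c p * e p) = 0 ∧
  dz d p - dy e p - (a p * e p - b p * d p) - (d p * f p - e p ^ 2) = 0 ∧
  dy (b + f) p = dz (a + e) p

/-- The coefficients as Christoffel symbols `Γ i j k` $= \Gamma^i_{jk}$ of a symmetric connection
in the variables `(y, z)`, with the index `0` for `y` and the index `1` for `z`. -/
def Coeffs.Γ (B : Coeffs) : Fin 2 → Fin 2 → Fin 2 → ℝ × ℝ → ℝ :=
  ![![![B.B222, B.B223], ![B.B223, B.B233]],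
    ![![B.B322, B.B323], ![B.B323, B.B333]]]

/-- The partial derivatives with respect to `y` (index `0`) and `z` (index `1`). -/
noncomputable def partialDeriv : Fin 2 → (ℝ × ℝ → ℝ) → ℝ × ℝ → ℝ := ![dy, dz]

/-- The Riemann curvature tensor $R^i_{\,jkl}=\Gamma^i_{jl,k}-\Gamma^i_{jk,l}
+\Gamma^i_{mk}\Gamma^m_{jl}-\Gamma^i_{ml}\Gamma^m_{jk}$. -/
noncomputable def Coeffs.riemann (B : Coeffs) (i j k l : Fin 2) (p : ℝ × ℝ) : ℝ :=
  partialDeriv k (B.Γ i j l) p - partialDeriv l (B.Γ i j k) p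
    + ∑ m, B.Γ i m k p * B.Γ m j l p - ∑ m, B.Γ i m l p * B.Γ m j k p

end QuadLin

set_option maxSynthPendingDepth 3

/-! The system reads γ'' = -Γ(γ', γ'), so its solutions are the affinely parametrized geodesics of
the symmetric connection Γ with coefficients B. The four conditions are invertible linear
combinations of the components R^i_{j01} of its curvature, so they say that Γ is flat.

If Γ is flat, the total linear system DX(u) = X ∘ Γ(u) is integrable, and the linear Frobenius
theorem `exists_hasFDerivAt_of_integrable` solves it with X = id at the base point. Symmetry of Γ
makes the form X closed, so X = Dφ. In the chart φ geodesics become straight lines at constant speed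
(`geodesic_iff_of_flat_chart`), and (x, p) ↦ (x, φ p) linearizes the system.

Conversely, let Φ be any linearizing transformation, possibly mixing x with y and z. Pull the flat
connection of ℝ³ back to N = DΦ⁻¹ D²Φ, which is again symmetric and flat. Its geodesics are
preimages of straight lines, hence graphs of solutions up to parametrization, so N(ξ, ξ) - (0, Γ(ξ₂,
ξ₂)) is parallel to ξ, where ξ₂ is the (y, z)-part of ξ. Thus on (y, z)-directions N(v, w) = Γ(v, w)
+ μ(v) w + μ(w) v for a linear form μ (`projective_change_of_parallel`). A mixed component of the
flatness of N gives Dμ(u, w) = μ(Γ(u, w)) + μ(u) μ(w). This is what removes μ from the curvature, so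
Γ itself is flat (`curvature_eq_zero_of_projective_change`). -/

namespace QuadLin

open Set Filter Topology Metric

/-! ### Linear total differential systems, solved along rays. -/

section Frobenius

variable {V E : Type*} [NormedAddCommGroup V] [NormedSpace ℝ V] [NormedAddCommGroup E]
  [NormedSpace ℝ E]

/-- A linear ordinary differential equation with coefficient of norm at most `1 / 2` has a solution
on `[0, 1]`. -/
theorem exists_hasDerivWithinAt_of_norm_le_half [CompleteSpace E] {L : ℝ → E →L[ℝ] E}
    (hL : ContinuousOn L (Icc 0 1)) (hb : ∀ t ∈ Icc (0 : ℝ) 1, ‖L t‖ ≤ 1 / 2) (x₀ : E) :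
    ∃ γ : ℝ → E, γ 0 = x₀ ∧
      ∀ t ∈ Icc (0 : ℝ) 1, HasDerivWithinAt γ (L t (γ t)) (Icc 0 1) t := by
  -- On the ball of radius ‖x₀‖ + 1 about x₀ the field has norm at most (2‖x₀‖ + 1)/2 ≤ ‖x₀‖ + 1, so
  -- the solution cannot leave the ball in unit time.
  have h : IsPicardLindelof (fun t x => L t x) (⟨0, by simp⟩ : Icc (0 : ℝ) 1) x₀
      (‖x₀‖₊ + 1) 0 (‖x₀‖₊ + 1) 1 := by
    refine ⟨fun t ht => ?_, fun x _ => hL.clm_apply continuousOn_const, fun t ht x hx => ?_, ?_⟩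
    · refine LipschitzWith.lipschitzOnWith (LipschitzWith.of_dist_le_mul fun x y => ?_)
      rw [dist_eq_norm, dist_eq_norm, ← map_sub]
      have h1 := (L t).le_of_opNorm_le (hb t ht) (x - y)
      have h2 := norm_nonneg (x - y)
      push_cast
      linarith
    · have h1 := (L t).le_of_opNorm_le (hb t ht) x
      have h2 : ‖x‖ ≤ ‖x₀‖ + (‖x₀‖ + 1) := by
        have h3 : ‖x - x₀‖ ≤ ‖x₀‖ + 1 := by simpa [dist_eq_norm] using hx
        have h4 := norm_add_le x₀ (x - x₀)
        rw [add_sub_cancel] at h4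
        linarith
      push_cast
      linarith
    · simp
  exact h.exists_eq_forall_mem_Icc_hasDerivWithinAt₀

/-- The pointwise identity behind the linear Frobenius theorem: it expresses the derivative of the
error of the first-order approximation through the error itself and quadratically small terms. -/
theorem radial_error_identity {A A' : V →L[ℝ] E →L[ℝ] E} {DA : V →L[ℝ] V →L[ℝ] E →L[ℝ] E}
    (hint : ∀ u v x, DA u v x + A v (A u x) = DA v u x + A u (A v x)) (q h k : V) (g g' : E) :
    A' (q + h) g' - A q g - (DA q k g + A h g + A k (A q g)) =
      A' (q + h) (g' - g - A k g) + ((A' - A - DA k) (q + h) g + DA k h g +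
        (A' - A) (q + h) (A k g) + A h (A k g)) := by
  have h1 := hint q k g
  simp only [map_add, map_sub, add_apply, sub_apply]
  rw [← sub_eq_zero] at h1 ⊢
  rw [← neg_eq_zero, ← h1]
  abel

/-- Along rays from `p₀`, solutions of the radial equations depend on the ray differentiably, with
the derivative that the total system prescribes. -/
theorem norm_radial_sub_le {M : V → V →L[ℝ] E →L[ℝ] E} {p₀ : V} {r C G : ℝ} (hC : 1 ≤ C)
    (hr1 : r ≤ 1) (hrC : C * r ≤ 1 / 2) (hM : ∀ p ∈ ball p₀ r, ‖M p‖ ≤ C)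
    (hd : ∀ p ∈ ball p₀ r, DifferentiableAt ℝ M p)
    (hDM : ∀ p ∈ ball p₀ r, ‖fderiv ℝ M p‖ ≤ C)
    (hDL : ∀ p ∈ ball p₀ r, ∀ p' ∈ ball p₀ r, ‖M p' - M p - fderiv ℝ M p (p' - p)‖
      ≤ C * ‖p' - p‖ ^ 2)
    (hint : ∀ p ∈ ball p₀ r, ∀ u v x, fderiv ℝ M p u v x + M p v (M p u x) =
      fderiv ℝ M p v u x + M p u (M p v x))
    {q h : V} (hq : ‖q‖ < r) (hqh : ‖q + h‖ < r) {g g' : ℝ → E}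
    (hG : ∀ t ∈ Icc (0 : ℝ) 1, ‖g t‖ ≤ G) (h0 : g' 0 = g 0)
    (hg : ∀ t ∈ Icc (0 : ℝ) 1, HasDerivWithinAt g (M (p₀ + t • q) q (g t)) (Icc 0 1) t)
    (hg' : ∀ t ∈ Icc (0 : ℝ) 1,
      HasDerivWithinAt g' (M (p₀ + t • (q + h)) (q + h) (g' t)) (Icc 0 1) t) :
    ‖g' 1 - g 1 - M (p₀ + q) h (g 1)‖ ≤ 4 * C ^ 2 * G * (Real.exp 1 - 1) * ‖h‖ ^ 2 := by
  have hmem : ∀ k : V, ‖k‖ < r → ∀ t ∈ Icc (0 : ℝ) 1, p₀ + t • k ∈ ball p₀ r := by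
    intro k hk t ht
    rw [mem_ball, dist_eq_norm, add_sub_cancel_left, norm_smul, Real.norm_of_nonneg ht.1]
    nlinarith [ht.2, norm_nonneg k]
  -- At time t the two rays are t • h apart, so D is the error of the prescribed first-order
  -- approximation. It vanishes at 0, and Grönwall's inequality bounds it at 1.
  set D : ℝ → E := fun t => g' t - g t - M (p₀ + t • q) (t • h) (g t) with hD
  have hder : ∀ t ∈ Icc (0 : ℝ) 1, HasDerivWithinAt D
      (M (p₀ + t • (q + h)) (q + h) (g' t) - M (p₀ + t • q) q (g t) -
        (fderiv ℝ M (p₀ + t • q) q (t • h) (g t) + M (p₀ + t • q) h (g t) +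
          M (p₀ + t • q) (t • h) (M (p₀ + t • q) q (g t)))) (Icc 0 1) t := by
    intro t ht
    have e1 : HasDerivWithinAt (fun t : ℝ => p₀ + t • q) q (Icc 0 1) t := by
      simpa using ((hasDerivAt_id t).smul_const q).const_add p₀ |>.hasDerivWithinAt
    have e2 : HasDerivWithinAt (fun t : ℝ => t • h) h (Icc 0 1) t := by
      simpa using ((hasDerivAt_id t).smul_const h).hasDerivWithinAt
    have e3 : HasDerivWithinAt (fun t : ℝ => M (p₀ + t • q)) (fderiv ℝ M (p₀ + t • q) q)
        (Icc 0 1) t :=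
      (hd _ (hmem q hq t ht)).hasFDerivAt.comp_hasDerivWithinAt t e1
    have := ((hg' t ht).sub (hg t ht)).sub ((e3.clm_apply e2).clm_apply (hg t ht))
    refine this.congr_deriv ?_
    simp only [add_apply]
  have hcont : ContinuousOn D (Icc 0 1) := fun t ht => (hder t ht).continuousWithinAt
  have hG0 : 0 ≤ G := (norm_nonneg _).trans (hG 0 (by simp))
  have hC0 : 0 ≤ C := by linarith
  have hbd : ∀ t ∈ Ico (0 : ℝ) 1, ‖M (p₀ + t • (q + h)) (q + h) (g' t) - M (p₀ + t • q) q (g t) -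
        (fderiv ℝ M (p₀ + t • q) q (t • h) (g t) + M (p₀ + t • q) h (g t) +
          M (p₀ + t • q) (t • h) (M (p₀ + t • q) q (g t)))‖
        ≤ 1 * ‖D t‖ + 4 * C ^ 2 * G * ‖h‖ ^ 2 := by
    intro t ht'
    have ht : t ∈ Icc (0 : ℝ) 1 := ⟨ht'.1, ht'.2.le⟩
    have hP := hmem q hq t ht
    have hP' := hmem (q + h) hqh t ht
    -- Integrability cancels the terms linear in h. What remains is A' (q + h) (D t) and four terms
    -- of size at most C² G ‖h‖² (`n1` to `n4`), whence the constant 4 C² G.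
    rw [radial_error_identity (hint _ hP)]
    set A := M (p₀ + t • q)
    set A' := M (p₀ + t • (q + h))
    set DA := fderiv ℝ M (p₀ + t • q)
    have hk : ‖t • h‖ ≤ ‖h‖ := by
      rw [norm_smul, Real.norm_of_nonneg ht.1]
      nlinarith [ht.2, norm_nonneg h]
    have hpp : p₀ + t • (q + h) - (p₀ + t • q) = t • h := by rw [smul_add]; abel
    have hA : ‖A‖ ≤ C := hM _ hP
    have hA' : ‖A'‖ ≤ C := hM _ hP'
    have hDA : ‖DA‖ ≤ C := hDM _ hP
    have hh := norm_nonneg h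
    have hgt := hG t ht
    have hqh1 : ‖q + h‖ ≤ 1 := hqh.le.trans hr1
    have hrem : ‖A' - A - DA (t • h)‖ ≤ C * ‖h‖ ^ 2 := by
      have := hDL _ hP _ hP'
      rw [hpp] at this
      exact this.trans (by gcongr)
    have hlip : ‖A' - A‖ ≤ C * ‖h‖ := by
      have := (convex_ball p₀ r).norm_image_sub_le_of_norm_fderiv_le (𝕜 := ℝ) hd hDM hP hP'
      rw [hpp] at this
      exact this.trans (by gcongr)
    have hAk : ‖A (t • h) (g t)‖ ≤ C * ‖h‖ * G :=
      (A.le_opNorm₂ _ _).trans (by gcongr)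
    have n0 : ‖A' (q + h) (D t)‖ ≤ 1 * ‖D t‖ := by
      refine (A'.le_opNorm₂ _ _).trans ?_
      gcongr
      nlinarith [norm_nonneg (q + h)]
    have n1 : ‖(A' - A - DA (t • h)) (q + h) (g t)‖ ≤ C ^ 2 * G * ‖h‖ ^ 2 := by
      refine ((A' - A - DA (t • h)).le_opNorm₂ _ _).trans
        ((by gcongr : _ ≤ C * ‖h‖ ^ 2 * 1 * G).trans ?_)
      have : C * (‖h‖ ^ 2 * G) ≤ C ^ 2 * (‖h‖ ^ 2 * G) := by gcongr; nlinarith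
      linarith
    have n2 : ‖DA (t • h) h (g t)‖ ≤ C ^ 2 * G * ‖h‖ ^ 2 := by
      refine ((DA (t • h)).le_opNorm₂ _ _).trans
        ((by gcongr; exact (DA.le_opNorm _).trans (by gcongr) : _ ≤ (C * ‖h‖) * ‖h‖ * G).trans ?_)
      have : C * (‖h‖ ^ 2 * G) ≤ C ^ 2 * (‖h‖ ^ 2 * G) := by gcongr; nlinarith
      linarith
    have n3 : ‖(A' - A) (q + h) (A (t • h) (g t))‖ ≤ C ^ 2 * G * ‖h‖ ^ 2 := by
      refine ((A' - A).le_opNorm₂ _ _).trans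
        ((by gcongr : _ ≤ (C * ‖h‖) * 1 * (C * ‖h‖ * G)).trans (le_of_eq ?_))
      ring
    have n4 : ‖A h (A (t • h) (g t))‖ ≤ C ^ 2 * G * ‖h‖ ^ 2 := by
      refine (A.le_opNorm₂ _ _).trans
        ((by gcongr : _ ≤ C * ‖h‖ * (C * ‖h‖ * G)).trans (le_of_eq ?_))
      ring
    have := norm_add_le (A' (q + h) (D t)) ((A' - A - DA (t • h)) (q + h) (g t) +
      DA (t • h) h (g t) + (A' - A) (q + h) (A (t • h) (g t)) + A h (A (t • h) (g t)))
    have := norm_add₄_le (a := (A' - A - DA (t • h)) (q + h) (g t))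
      (b := DA (t • h) h (g t)) (c := (A' - A) (q + h) (A (t • h) (g t)))
      (d := A h (A (t • h) (g t)))
    simp only [hD] at *
    linarith
  have hgr := norm_le_gronwallBound_of_norm_deriv_right_le (δ := 0) hcont
    (fun t ht => (hder t ⟨ht.1, ht.2.le⟩).mono_of_mem_nhdsWithin (Icc_mem_nhdsGE_of_mem ht))
    (by simp [hD, h0]) hbd 1 (by simp)
  rw [gronwallBound_of_K_ne_0 one_ne_zero] at hgr
  simp only [hD, one_smul, sub_zero] at hgr
  refine hgr.trans (le_of_eq ?_)
  simp only [mul_one]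
  ring

/-- **Linear Frobenius theorem.** The total linear system `DX(p) v = M p v X` with `M` of class `C²`
has a solution with any given initial value, if its integrability condition holds. -/
theorem exists_hasFDerivAt_of_integrable [CompleteSpace E] {M : V → V →L[ℝ] E →L[ℝ] E} {p₀ : V}
    (hM : ContDiffAt ℝ 2 M p₀)
    (hint : ∀ᶠ p in 𝓝 p₀, ∀ u v x, fderiv ℝ M p u v x + M p v (M p u x) =
      fderiv ℝ M p v u x + M p u (M p v x)) (x₀ : E) :
    ∃ X : V → E, X p₀ = x₀ ∧ ∀ᶠ p in 𝓝 p₀, HasFDerivAt X ((M p).flip (X p)) p := by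
  have hM' : ContDiffAt ℝ 1 (fderiv ℝ M) p₀ := hM.fderiv_right (by norm_num)
  obtain ⟨K, s, hs, hK⟩ := hM'.exists_lipschitzOnWith
  set C : ℝ := max (max 1 K) (max (‖M p₀‖ + 1) (‖fderiv ℝ M p₀‖ + 1)) with hCdef
  have hC1 : 1 ≤ C := (le_max_left _ _).trans (le_max_left _ _)
  have hCK : (K : ℝ) ≤ C := (le_max_right _ _).trans (le_max_left _ _)
  have hCM : ‖M p₀‖ < C :=
    (lt_add_one _).trans_le ((le_max_left _ _).trans (le_max_right _ _))
  have hCD : ‖fderiv ℝ M p₀‖ < C :=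
    (lt_add_one _).trans_le ((le_max_right _ _).trans (le_max_right _ _))
  have hev : ∀ᶠ p in 𝓝 p₀, p ∈ s ∧ (∀ u v x, fderiv ℝ M p u v x + M p v (M p u x) =
      fderiv ℝ M p v u x + M p u (M p v x)) ∧ ‖M p‖ ≤ C ∧ ‖fderiv ℝ M p‖ ≤ C ∧
      DifferentiableAt ℝ M p := by
    refine (Filter.eventually_of_mem hs fun _ => id).and (hint.and ?_)
    refine ((hM.continuousAt.norm.eventually_lt_const hCM).mono fun _ => le_of_lt).and
      (((hM'.continuousAt.norm.eventually_lt_const hCD).mono fun _ => le_of_lt).and ?_)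
    exact (hM.eventually (by simp)).mono fun p hp => hp.differentiableAt (by norm_num)
  obtain ⟨r₁, hr₁, hball⟩ := Metric.eventually_nhds_iff_ball.1 hev
  -- This radius gives C * r ≤ 1 / 2, the smallness that makes each ray equation solvable up to time
  -- 1.
  set r : ℝ := min r₁ (1 / (2 * C)) with hrdef
  have hC0 : 0 < C := by linarith
  have hr0 : 0 < r := lt_min hr₁ (by positivity)
  have hrC : C * r ≤ 1 / 2 := by
    calc C * r ≤ C * (1 / (2 * C)) := by gcongr; exact min_le_right _ _
      _ = 1 / 2 := by field_simp
  have hr1 : r ≤ 1 := by nlinarith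
  have hb : ∀ p ∈ ball p₀ r, p ∈ ball p₀ r₁ := fun p hp => ball_subset_ball (min_le_left _ _) hp
  have hmem : ∀ k : V, ‖k‖ < r → ∀ t ∈ Icc (0 : ℝ) 1, p₀ + t • k ∈ ball p₀ r := by
    intro k hk t ht
    rw [mem_ball, dist_eq_norm, add_sub_cancel_left, norm_smul, Real.norm_of_nonneg ht.1]
    nlinarith [ht.2, norm_nonneg k]
  have hsol : ∀ q : V, ‖q‖ < r → ∃ γ : ℝ → E, γ 0 = x₀ ∧ ∀ t ∈ Icc (0 : ℝ) 1,
      HasDerivWithinAt γ (M (p₀ + t • q) q (γ t)) (Icc 0 1) t := by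
    intro q hq
    refine exists_hasDerivWithinAt_of_norm_le_half (L := fun t => M (p₀ + t • q) q)
      (ContinuousOn.clm_apply ?_ continuousOn_const) ?_ x₀
    · intro t ht
      have h1 : ContinuousAt M (p₀ + t • q) :=
        (hball _ (hb _ (hmem q hq t ht))).2.2.2.2.continuousAt
      have h2 : ContinuousAt (fun t : ℝ => p₀ + t • q) t := by fun_prop
      exact (ContinuousAt.comp (f := fun t : ℝ => p₀ + t • q) h1 h2).continuousWithinAt
    · intro t ht
      have h1 := (hball _ (hb _ (hmem q hq t ht))).2.2.1
      refine ((M _).le_of_opNorm_le h1 q).trans ?_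
      nlinarith [norm_nonneg q]
  choose! γ hγ0 hγ using hsol
  have hDL : ∀ p ∈ ball p₀ r, ∀ p' ∈ ball p₀ r,
      ‖M p' - M p - fderiv ℝ M p (p' - p)‖ ≤ C * ‖p' - p‖ ^ 2 := by
    intro p hp p' hp'
    have hseg : segment ℝ p p' ⊆ ball p₀ r := (convex_ball p₀ r).segment_subset hp hp'
    have := (convex_segment p p').norm_image_sub_le_of_norm_fderiv_le' (𝕜 := ℝ) (f := M)
      (φ := fderiv ℝ M p) (C := C * ‖p' - p‖)
      (fun z hz => (hball _ (hb _ (hseg hz))).2.2.2.2) (fun z hz => ?_)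
      (left_mem_segment ℝ p p') (right_mem_segment ℝ p p')
    · rw [sq, ← mul_assoc]
      exact this
    · have h1 := hK.dist_le_mul z (hball _ (hb _ (hseg hz))).1 p (hball _ (hb _ hp)).1
      rw [dist_eq_norm, dist_eq_norm] at h1
      refine h1.trans ?_
      gcongr
      obtain ⟨θ, hθ, rfl⟩ := (segment_eq_image' ℝ p p') ▸ hz
      rw [add_sub_cancel_left, norm_smul, Real.norm_of_nonneg hθ.1]
      nlinarith [hθ.2, norm_nonneg (p' - p)]
  -- X p is obtained by transporting x₀ along the segment from p₀ to p. At p₀ the ray is a point and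
  -- the solution is constant.
  refine ⟨fun p => γ (p - p₀) 1, ?_, ?_⟩
  · have h1 : ∀ t ∈ Icc (0 : ℝ) 1, HasDerivWithinAt (γ 0) 0 (Icc 0 1) t := by
      intro t ht
      simpa using hγ 0 (by simpa using hr0) t ht
    have h2 := (convex_Icc (0 : ℝ) 1).is_const_of_fderivWithin_eq_zero (𝕜 := ℝ) (f := γ 0)
      (fun t ht => (h1 t ht).differentiableWithinAt) (fun t ht => ?_)
      (x := 0) (y := 1) (by simp) (by simp)
    · simp only [sub_self]
      rw [← h2, hγ0 0 (by simpa using hr0)]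
    · have := (h1 t ht).hasFDerivWithinAt.fderivWithin
        (uniqueDiffOn_Icc_zero_one t ht)
      rw [this]
      ext
      simp
  · filter_upwards [ball_mem_nhds p₀ hr0] with p hp
    have hq : ‖p - p₀‖ < r := by rwa [mem_ball, dist_eq_norm] at hp
    obtain ⟨G, hG⟩ := (isCompact_Icc (a := (0 : ℝ)) (b := 1)).exists_bound_of_continuousOn
      (f := γ (p - p₀)) fun t ht => (hγ _ hq t ht).continuousWithinAt
    refine HasFDerivAt.of_isLittleO ?_
    have hO : (fun p' => γ (p' - p₀) 1 - γ (p - p₀) 1 -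
        (M p).flip (γ (p - p₀) 1) (p' - p)) =O[𝓝 p] fun p' => ‖p' - p‖ ^ 2 := by
      refine Asymptotics.IsBigO.of_bound (4 * C ^ 2 * G * (Real.exp 1 - 1)) ?_
      filter_upwards [isOpen_ball.mem_nhds hp] with p' hp'
      have hqh : ‖p - p₀ + (p' - p)‖ < r := by
        rw [mem_ball, dist_eq_norm] at hp'
        rwa [show p - p₀ + (p' - p) = p' - p₀ by abel]
      have := norm_radial_sub_le hC1 hr1 hrC (fun p hp => (hball _ (hb _ hp)).2.2.1)
        (fun p hp => (hball _ (hb _ hp)).2.2.2.2) (fun p hp => (hball _ (hb _ hp)).2.2.2.1) hDL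
        (fun p hp => (hball _ (hb _ hp)).2.1) hq hqh hG ((hγ0 _ hqh).trans (hγ0 _ hq).symm)
        (hγ _ hq) (hγ _ hqh)
      rw [show p - p₀ + (p' - p) = p' - p₀ by abel, add_sub_cancel] at this
      simpa using this
    exact hO.trans_isLittleO (Asymptotics.isLittleO_pow_sub_sub p one_lt_two)

end Frobenius

/-! ### The three forms of the conditions. -/

section

variable {U : Set (ℝ × ℝ)} {B : Coeffs} {p : ℝ × ℝ}

/-- The first three flatness expressions are R^0_{001}, R^0_{101} and R^1_{001}; the fourth
condition says that the trace R^0_{001} + R^1_{101} vanishes. Differentiability is needed to split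
the derivatives of b + f and a + e. -/
theorem Coeffs.fourConditionsAt_iff_flatnessConditionsAt (hU : IsOpen U) (hB : B.SmoothOn U)
    (hp : p ∈ U) : B.FourConditionsAt p ↔
      FlatnessConditionsAt (-B.B222) (-B.B223) (-B.B233) (-B.B322) (-B.B323) (-B.B333) p := by
  have hd : ∀ {f : ℝ × ℝ → ℝ}, ContDiffOn ℝ ∞ f U → DifferentiableAt ℝ f p := fun hf =>
    (hf.contDiffAt (hU.mem_nhds hp)).differentiableAt (by simp)
  have hneg : ∀ (f : ℝ × ℝ → ℝ) (v : ℝ × ℝ), fderiv ℝ (-f) p v = -fderiv ℝ f p v := by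
    intro f v
    rw [fderiv_neg, neg_apply]
  have hadd : ∀ {f g : ℝ × ℝ → ℝ}, DifferentiableAt ℝ f p → DifferentiableAt ℝ g p →
      ∀ v, fderiv ℝ (-f + -g) p v = -fderiv ℝ f p v - fderiv ℝ g p v := by
    intro f g hf hg v
    rw [fderiv_add hf.neg hg.neg, add_apply, hneg, hneg]
    ring
  obtain ⟨h1, h2, h3, h4, h5, h6⟩ := hB
  simp only [Coeffs.FourConditionsAt, FlatnessConditionsAt, dy, dz, hneg,
    hadd (hd h2) (hd h6), hadd (hd h1) (hd h5), Pi.neg_apply]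
  constructor
  · rintro ⟨e1, e2, e3, e4⟩
    refine ⟨?_, ?_, ?_, ?_⟩
    · linear_combination (1 / 2) * e2 - 2 * e3
    · linear_combination -e4
    · linear_combination e1
    · linear_combination -(3 / 2) * e2 + 3 * e3
  · rintro ⟨f1, f2, f3, f4⟩
    refine ⟨?_, ?_, ?_, ?_⟩
    · linear_combination f3
    · linear_combination -2 * f1 - (4 / 3) * f4
    · linear_combination -f1 - (1 / 3) * f4
    · linear_combination -f2

/-- By antisymmetry in k, l only the four components R^i_{j01} matter. The outer two conditions are
R^1_{001} and -R^0_{101}; the middle two are independent combinations of R^0_{001} and R^1_{101}. -/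
theorem Coeffs.fourConditionsAt_iff_riemann_eq_zero :
    B.FourConditionsAt p ↔ ∀ i j k l : Fin 2, B.riemann i j k l p = 0 := by
  simp only [Coeffs.FourConditionsAt, Fin.forall_fin_two, Coeffs.riemann, Coeffs.Γ, partialDeriv,
    Fin.sum_univ_two, Matrix.cons_val_zero, Matrix.cons_val_one]
  constructor
  · rintro ⟨e1, e2, e3, e4⟩
    refine ⟨⟨⟨⟨?_, ?_⟩, ?_, ?_⟩, ⟨?_, ?_⟩, ?_, ?_⟩, ⟨⟨?_, ?_⟩, ?_, ?_⟩, ⟨?_, ?_⟩, ?_, ?_⟩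
    · ring
    · linear_combination (1 / 2) * e2 - 2 * e3
    · linear_combination -(1 / 2) * e2 + 2 * e3
    · ring
    · ring
    · linear_combination -e4
    · linear_combination e4
    · ring
    · ring
    · linear_combination e1
    · linear_combination -e1
    · ring
    · ring
    · linear_combination e2 - e3
    · linear_combination -e2 + e3
    · ring
  · rintro ⟨⟨⟨⟨-, f1⟩, -⟩, ⟨-, f2⟩, -⟩, ⟨⟨-, f3⟩, -⟩, ⟨-, f4⟩, -⟩
    refine ⟨?_, ?_, ?_, ?_⟩
    · linear_combination f3
    · linear_combination (4 / 3) * f4 - (2 / 3) * f1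
    · linear_combination (1 / 3) * f4 - (2 / 3) * f1
    · linear_combination -f2

end

/-! ### The connection as a bilinear form, and its curvature. -/

section

variable {U : Set (ℝ × ℝ)} {B : Coeffs} {p : ℝ × ℝ}

/-- The bilinear map `(ξ, η) ↦ k ξ • l η • v`. -/
noncomputable def coordBilin (k l : ℝ × ℝ →L[ℝ] ℝ) (v : ℝ × ℝ) :
    ℝ × ℝ →L[ℝ] ℝ × ℝ →L[ℝ] ℝ × ℝ :=
  k.smulRight (l.smulRight v)

/-- The Christoffel form `(ξ, η) ↦ Γᵃ_bc ξᵇ ηᶜ` of the connection with coefficients `B`. -/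
noncomputable def Coeffs.conn (B : Coeffs) (p : ℝ × ℝ) : ℝ × ℝ →L[ℝ] ℝ × ℝ →L[ℝ] ℝ × ℝ :=
  let k := ContinuousLinearMap.fst ℝ ℝ ℝ
  let l := ContinuousLinearMap.snd ℝ ℝ ℝ
  B.B222 p • coordBilin k k (1, 0) +
    B.B223 p • (coordBilin k l (1, 0) + coordBilin l k (1, 0)) +
    B.B233 p • coordBilin l l (1, 0) +
    B.B322 p • coordBilin k k (0, 1) +
    B.B323 p • (coordBilin k l (0, 1) + coordBilin l k (0, 1)) +
    B.B333 p • coordBilin l l (0, 1)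

theorem Coeffs.conn_apply (ξ η : ℝ × ℝ) : B.conn p ξ η =
    (B.B222 p * (ξ.1 * η.1) + B.B223 p * (ξ.1 * η.2 + ξ.2 * η.1) + B.B233 p * (ξ.2 * η.2),
      B.B322 p * (ξ.1 * η.1) + B.B323 p * (ξ.1 * η.2 + ξ.2 * η.1) + B.B333 p * (ξ.2 * η.2)) := by
  ext <;> simp [Coeffs.conn, coordBilin] <;> ring

theorem Coeffs.conn_symm (ξ η : ℝ × ℝ) : B.conn p ξ η = B.conn p η ξ := by
  simp only [Coeffs.conn_apply]
  ext <;> ring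

theorem Coeffs.SmoothOn.conn (hB : B.SmoothOn U) : ContDiffOn ℝ ∞ B.conn U := by
  obtain ⟨h1, h2, h3, h4, h5, h6⟩ := hB
  exact (((((h1.smul contDiffOn_const).add (h2.smul contDiffOn_const)).add
    (h3.smul contDiffOn_const)).add (h4.smul contDiffOn_const)).add
    (h5.smul contDiffOn_const)).add (h6.smul contDiffOn_const)

theorem Coeffs.SmoothOn.fderiv_conn_apply (hU : IsOpen U) (hB : B.SmoothOn U) (hp : p ∈ U)
    (u ξ η : ℝ × ℝ) : fderiv ℝ B.conn p u ξ η =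
    (fderiv ℝ B.B222 p u * (ξ.1 * η.1) + fderiv ℝ B.B223 p u * (ξ.1 * η.2 + ξ.2 * η.1) +
      fderiv ℝ B.B233 p u * (ξ.2 * η.2),
     fderiv ℝ B.B322 p u * (ξ.1 * η.1) + fderiv ℝ B.B323 p u * (ξ.1 * η.2 + ξ.2 * η.1) +
      fderiv ℝ B.B333 p u * (ξ.2 * η.2)) := by
  have hd : ∀ {f : ℝ × ℝ → ℝ}, ContDiffOn ℝ ∞ f U →
      ∀ c : ℝ × ℝ →L[ℝ] ℝ × ℝ →L[ℝ] ℝ × ℝ,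
      HasFDerivAt (fun q => f q • c) ((fderiv ℝ f p).smulRight c) p := fun hf c =>
    ((hf.contDiffAt (hU.mem_nhds hp)).differentiableAt (by simp)).hasFDerivAt.smul_const c
  obtain ⟨h1, h2, h3, h4, h5, h6⟩ := hB
  let k := ContinuousLinearMap.fst ℝ ℝ ℝ
  let l := ContinuousLinearMap.snd ℝ ℝ ℝ
  have h := (((((hd h1 (coordBilin k k (1, 0))).add
    (hd h2 (coordBilin k l (1, 0) + coordBilin l k (1, 0)))).add
    (hd h3 (coordBilin l l (1, 0)))).add (hd h4 (coordBilin k k (0, 1)))).add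
    (hd h5 (coordBilin k l (0, 1) + coordBilin l k (0, 1)))).add (hd h6 (coordBilin l l (0, 1)))
  have h' : fderiv ℝ B.conn p = _ := HasFDerivAt.fderiv h
  rw [h']
  ext <;> simp [coordBilin, k, l] <;> ring

/-- At a point the curvature of the connection vanishes if and only if the four conditions hold. -/
theorem Coeffs.SmoothOn.fourConditionsAt_iff_curvature_eq_zero (hU : IsOpen U)
    (hB : B.SmoothOn U) (hp : p ∈ U) : B.FourConditionsAt p ↔ ∀ u v x : ℝ × ℝ,
      fderiv ℝ B.conn p u v x + B.conn p u (B.conn p v x) =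
        fderiv ℝ B.conn p v u x + B.conn p v (B.conn p u x) := by
  have hlin : ∀ (f : ℝ × ℝ → ℝ) (u : ℝ × ℝ),
      fderiv ℝ f p u = u.1 * dy f p + u.2 * dz f p := by
    intro f u
    conv_lhs => rw [show u = u.1 • ((1 : ℝ), (0 : ℝ)) + u.2 • ((0 : ℝ), (1 : ℝ)) by ext <;> simp]
    rw [map_add, map_smul, map_smul]
    rfl
  rw [Coeffs.fourConditionsAt_iff_riemann_eq_zero]
  simp only [hB.fderiv_conn_apply hU hp, Coeffs.conn_apply, hlin]
  simp only [Fin.forall_fin_two, Coeffs.riemann, Coeffs.Γ, partialDeriv,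
    Fin.sum_univ_two, Matrix.cons_val_zero, Matrix.cons_val_one]
  constructor
  -- The curvature is alternating in u, v, so it is u₁ v₂ - u₂ v₁ times its value on the coordinate
  -- basis.
  · rintro ⟨⟨⟨⟨-, f1⟩, -⟩, ⟨-, f2⟩, -⟩, ⟨⟨-, f3⟩, -⟩, ⟨-, f4⟩, -⟩ ⟨u₁, u₂⟩ ⟨v₁, v₂⟩ ⟨x₁, x₂⟩
    ext
    · simp only [Prod.fst_add]
      linear_combination (u₁ * v₂ - u₂ * v₁) * (x₁ * f1 + x₂ * f2)
    · simp only [Prod.snd_add]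
      linear_combination (u₁ * v₂ - u₂ * v₁) * (x₁ * f3 + x₂ * f4)
  · intro h
    have h1 := h (1, 0) (0, 1) (1, 0)
    have h2 := h (1, 0) (0, 1) (0, 1)
    simp only [Prod.ext_iff, Prod.fst_add, Prod.snd_add, mul_one, mul_zero, zero_mul, add_zero,
      zero_add, one_mul] at h1 h2
    obtain ⟨f1, f3⟩ := h1
    obtain ⟨f2, f4⟩ := h2
    refine ⟨⟨⟨⟨?_, ?_⟩, ?_, ?_⟩, ⟨?_, ?_⟩, ?_, ?_⟩, ⟨⟨?_, ?_⟩, ?_, ?_⟩, ⟨?_, ?_⟩, ?_, ?_⟩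
    · ring
    · linear_combination f1
    · linear_combination -f1
    · ring
    · ring
    · linear_combination f2
    · linear_combination -f2
    · ring
    · ring
    · linear_combination f3
    · linear_combination -f3
    · ring
    · ring
    · linear_combination f4
    · linear_combination -f4
    · ring

end

/-! ### Flat coordinates. -/

section

variable {U : Set (ℝ × ℝ)} {B : Coeffs} {p : ℝ × ℝ}

/-- A flat symmetric connection has flat coordinates: near each point there is a chart `φ` whose
second derivative is `D²φ (u, v) = Dφ (Γ (u, v))`. -/
theorem Coeffs.SmoothOn.exists_flat_chart (hU : IsOpen U) (hB : B.SmoothOn U)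
    (hflat : ∀ p ∈ U, B.FourConditionsAt p) {p₀ : ℝ × ℝ} (hp₀ : p₀ ∈ U) :
    ∃ φ : OpenPartialHomeomorph (ℝ × ℝ) (ℝ × ℝ), p₀ ∈ φ.source ∧ φ.source ⊆ U ∧
      ContDiffOn ℝ ∞ φ φ.source ∧ ContDiffOn ℝ ∞ φ.symm φ.target ∧
      ∃ G : ℝ × ℝ → ℝ × ℝ →L[ℝ] ℝ × ℝ, ∀ p ∈ φ.source, HasFDerivAt φ (G p) p ∧
        Function.Injective (G p) ∧ DifferentiableAt ℝ G p ∧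
        ∀ u v, fderiv ℝ G p u v = G p (B.conn p u v) := by
  -- Since C A G = G ∘ A, the system is DX(u) = X ∘ Γ(u). Precomposition reverses the order of
  -- products, which turns the Frobenius condition into vanishing curvature.
  set C : (ℝ × ℝ →L[ℝ] ℝ × ℝ) →L[ℝ] (ℝ × ℝ →L[ℝ] ℝ × ℝ) →L[ℝ] (ℝ × ℝ →L[ℝ] ℝ × ℝ) :=
    (ContinuousLinearMap.compL ℝ (ℝ × ℝ) (ℝ × ℝ) (ℝ × ℝ)).flip with hC
  have hCapp : ∀ A G : ℝ × ℝ →L[ℝ] ℝ × ℝ, C A G = G.comp A := fun _ _ => rfl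
  set M : ℝ × ℝ → ℝ × ℝ →L[ℝ] (ℝ × ℝ →L[ℝ] ℝ × ℝ) →L[ℝ] (ℝ × ℝ →L[ℝ] ℝ × ℝ) :=
    fun p => C.comp (B.conn p) with hM
  have hconn : ∀ p ∈ U, ContDiffAt ℝ ∞ B.conn p := fun p hp =>
    hB.conn.contDiffAt (hU.mem_nhds hp)
  have hfM : ∀ p ∈ U, ∀ u, fderiv ℝ M p u = C.comp (fderiv ℝ B.conn p u) := by
    intro p hp u
    have h1 : HasFDerivAt B.conn (fderiv ℝ B.conn p) p :=
      ((hconn p hp).differentiableAt (by simp)).hasFDerivAt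
    have h2 := (ContinuousLinearMap.compL ℝ (ℝ × ℝ) (ℝ × ℝ →L[ℝ] ℝ × ℝ)
      ((ℝ × ℝ →L[ℝ] ℝ × ℝ) →L[ℝ] (ℝ × ℝ →L[ℝ] ℝ × ℝ)) C).hasFDerivAt.comp p h1
    have h3 : fderiv ℝ M p = _ := HasFDerivAt.fderiv h2
    rw [h3]
    rfl
  obtain ⟨X, hX0, hX⟩ := exists_hasFDerivAt_of_integrable (M := M) (p₀ := p₀)
    (contDiffAt_const.clm_comp ((hconn p₀ hp₀).of_le (by norm_cast)))
    (by
      filter_upwards [hU.mem_nhds hp₀] with p hp u v x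
      have := (hB.fourConditionsAt_iff_curvature_eq_zero hU hp).1 (hflat p hp) u v
      refine ContinuousLinearMap.ext fun w => ?_
      rw [hfM p hp, hfM p hp]
      simp only [hM, add_apply, ContinuousLinearMap.comp_apply, hCapp]
      rw [← map_add, ← map_add, this])
    (ContinuousLinearMap.id ℝ (ℝ × ℝ))
  -- The invertible operators form a neighbourhood of X p₀ = id.
  have hinv : ∀ᶠ p in 𝓝 p₀, 
      X p ∈ range (ContinuousLinearEquiv.toContinuousLinearMap (M₁ := ℝ × ℝ) (M₂ := ℝ × ℝ)
        (σ₁₂ := RingHom.id ℝ)) := by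
    have h1 := hX.self_of_nhds.continuousAt
    refine h1.eventually_mem ?_
    rw [hX0]
    exact ContinuousLinearEquiv.nhds (ContinuousLinearEquiv.refl ℝ (ℝ × ℝ))
  obtain ⟨r, hr, hball⟩ := Metric.eventually_nhds_iff_ball.1
    (hX.and (hinv.and (hU.mem_nhds hp₀)))
  have hXd : ∀ p ∈ ball p₀ r, ∀ u, fderiv ℝ X p u = (X p).comp (B.conn p u) := by
    intro p hp u
    rw [(hball p hp).1.fderiv]
    rfl
  have hXdiff : DifferentiableOn ℝ X (ball p₀ r) := fun p hp =>
    (hball p hp).1.differentiableAt.differentiableWithinAt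
  -- Poincaré lemma: the form X is closed because Γ is symmetric.
  obtain ⟨φ, hφ⟩ := (convex_ball p₀ r).exists_forall_hasFDerivAt_of_fderiv_symmetric isOpen_ball
    hXdiff (fun p hp u v => by
      rw [hXd p hp, hXd p hp, ContinuousLinearMap.comp_apply, ContinuousLinearMap.comp_apply,
        B.conn_symm])
  -- Bootstrapping: by DX = X ∘ Γ, the derivative of X is as regular as X.
  have hXn : ∀ n : ℕ, ContDiffOn ℝ n X (ball p₀ r) := by
    intro n
    induction n with
    | zero => exact contDiffOn_zero.2 hXdiff.continuousOn
    | succ n ih =>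
      push_cast
      refine (contDiffOn_succ_iff_fderiv_of_isOpen isOpen_ball).2 ⟨hXdiff, by simp, ?_⟩
      have h1 : ContDiffOn ℝ n (fun p =>
          (ContinuousLinearMap.compL ℝ (ℝ × ℝ) (ℝ × ℝ) (ℝ × ℝ) (X p)).comp (B.conn p))
          (ball p₀ r) := by
        refine ContDiffOn.clm_comp
          ((ContinuousLinearMap.contDiff _).comp_contDiffOn ih) fun p hp => ?_
        exact ((hconn p (hball p hp).2.2).of_le (by norm_cast; exact le_top)).contDiffWithinAt
      refine h1.congr fun p hp => ?_
      refine ContinuousLinearMap.ext fun u => ?_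
      rw [hXd p hp]
      rfl
  have hφs : ContDiffOn ℝ ∞ φ (ball p₀ r) := by
    refine (contDiffOn_infty_iff_fderiv_of_isOpen isOpen_ball).2
      ⟨fun p hp => (hφ p hp).differentiableAt.differentiableWithinAt, ?_⟩
    exact (contDiffOn_infty.2 hXn).congr fun p hp => (hφ p hp).fderiv
  have hp₀b : p₀ ∈ ball p₀ r := mem_ball_self hr
  obtain ⟨e₀, he₀⟩ := (hball p₀ hp₀b).2.1
  have hφ₀ : ContDiffAt ℝ ∞ φ p₀ := hφs.contDiffAt (isOpen_ball.mem_nhds hp₀b)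
  have hφ₀' : HasFDerivAt φ e₀.toContinuousLinearMap p₀ := by
    rw [he₀]
    exact hφ p₀ hp₀b
  set e := (hφ₀.toOpenPartialHomeomorph φ hφ₀' (by simp)).restrOpen (ball p₀ r) isOpen_ball
  have hes : e.source ⊆ ball p₀ r := fun p hp => hp.2
  have hecoe : (e : ℝ × ℝ → ℝ × ℝ) = φ := rfl
  refine ⟨e, ⟨hφ₀.mem_toOpenPartialHomeomorph_source hφ₀' (by simp), hp₀b⟩,
    fun p hp => (hball p (hes hp)).2.2, hφs.mono hes, fun q hq => ?_, X, fun p hp => ?_⟩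
  · have h1 := hes (e.map_target hq)
    obtain ⟨f, hf⟩ := (hball _ h1).2.1
    refine (e.contDiffAt_symm (f₀' := f) hq ?_ ?_).contDiffWithinAt
    · rw [hf]
      exact hφ _ h1
    · exact hφs.contDiffAt (isOpen_ball.mem_nhds h1)
  · have h1 := hes hp
    refine ⟨hφ p h1, ?_, (hball p h1).1.differentiableAt, fun u v => ?_⟩
    · obtain ⟨f, hf⟩ := (hball _ h1).2.1
      rw [← hf]
      exact f.injective
    · rw [hXd p h1]
      rfl

end

/-! ### Sufficiency: flat coordinates linearize the system. -/

section

variable {U : Set (ℝ × ℝ)} {B : Coeffs}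

theorem _root_.HasDerivAt.prodFst {E F : Type*} [NormedAddCommGroup E] [NormedSpace ℝ E]
    [NormedAddCommGroup F] [NormedSpace ℝ F] {γ : ℝ → E × F} {γ' : E × F} {x : ℝ}
    (h : HasDerivAt γ γ' x) : HasDerivAt (fun t => (γ t).1) γ'.1 x :=
  (ContinuousLinearMap.fst ℝ E F).hasFDerivAt.comp_hasDerivAt x h

theorem _root_.HasDerivAt.prodSnd {E F : Type*} [NormedAddCommGroup E] [NormedSpace ℝ E]
    [NormedAddCommGroup F] [NormedSpace ℝ F] {γ : ℝ → E × F} {γ' : E × F} {x : ℝ}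
    (h : HasDerivAt γ γ' x) : HasDerivAt (fun t => (γ t).2) γ'.2 x :=
  (ContinuousLinearMap.snd ℝ E F).hasFDerivAt.comp_hasDerivAt x h

/-- Solutions of an autonomous quadratically semi-linear system are the curves with
`γ'' = -Γ (γ', γ')`. -/
theorem Coeffs.isSolutionOn_system_iff {I : Set ℝ} {y z : ℝ → ℝ} :
    (B.system U).IsSolutionOn I y z ↔ ∃ γ₁ : ℝ → ℝ × ℝ, ∀ x ∈ I, (y x, z x) ∈ U ∧
      HasDerivAt (fun x => (y x, z x)) (γ₁ x) x ∧
      HasDerivAt γ₁ (-B.conn (y x, z x) (γ₁ x) (γ₁ x)) x := by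
  constructor
  · rintro ⟨y₁, z₁, h⟩
    refine ⟨fun x => (y₁ x, z₁ x), fun x hx => ?_⟩
    obtain ⟨h0, h1, h2, h3, h4⟩ := h x hx
    refine ⟨h0, h1.prodMk h2, (h3.prodMk h4).congr_deriv ?_⟩
    simp only [Coeffs.system, Coeffs.conn_apply]
    ext
    · simp only [Prod.fst_neg]
      ring
    · simp only [Prod.snd_neg]
      ring
  · rintro ⟨γ₁, h⟩
    refine ⟨fun x => (γ₁ x).1, fun x => (γ₁ x).2, fun x hx => ?_⟩
    obtain ⟨h0, h1, h2⟩ := h x hx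
    refine ⟨h0, h1.prodFst, h1.prodSnd, h2.prodFst.congr_deriv ?_, h2.prodSnd.congr_deriv ?_⟩
    · simp only [Coeffs.system, Coeffs.conn_apply, Prod.fst_neg]
      ring
    · simp only [Coeffs.system, Coeffs.conn_apply, Prod.snd_neg]
      ring

/-- Solutions of the free-particle system are the curves with `δ'' = 0`. -/
theorem isSolutionOn_freeParticle_iff {J : Set ℝ} {v w : ℝ → ℝ} :
    freeParticle.IsSolutionOn J v w ↔ ∃ δ₁ : ℝ → ℝ × ℝ, ∀ u ∈ J,
      HasDerivAt (fun u => (v u, w u)) (δ₁ u) u ∧ HasDerivAt δ₁ 0 u := by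
  constructor
  · rintro ⟨v₁, w₁, h⟩
    refine ⟨fun u => (v₁ u, w₁ u), fun u hu => ?_⟩
    obtain ⟨-, h1, h2, h3, h4⟩ := h u hu
    exact ⟨h1.prodMk h2, h3.prodMk h4⟩
  · rintro ⟨δ₁, h⟩
    refine ⟨fun u => (δ₁ u).1, fun u => (δ₁ u).2, fun u hu => ?_⟩
    obtain ⟨h1, h2⟩ := h u hu
    exact ⟨mem_univ _, h1.prodFst, h1.prodSnd, h2.prodFst, h2.prodSnd⟩

/-- Flat coordinates turn the geodesic equation into the equation of straight lines. -/
theorem geodesic_iff_of_flat_chart {φ : OpenPartialHomeomorph (ℝ × ℝ) (ℝ × ℝ)}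
    {G : ℝ × ℝ → ℝ × ℝ →L[ℝ] ℝ × ℝ} (hG : ∀ p ∈ φ.source, HasFDerivAt φ (G p) p ∧
      Function.Injective (G p) ∧ DifferentiableAt ℝ G p ∧
      ∀ u v, fderiv ℝ G p u v = G p (B.conn p u v))
    {I : Set ℝ} (hI : IsOpen I) {γ δ : ℝ → ℝ × ℝ} (hγ : ContDiffOn ℝ 2 γ I)
    (hmem : ∀ x ∈ I, γ x ∈ φ.source) (hδ : ∀ x ∈ I, φ (γ x) = δ x) :
    (∃ γ₁ : ℝ → ℝ × ℝ, ∀ x ∈ I, HasDerivAt γ (γ₁ x) x ∧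
      HasDerivAt γ₁ (-B.conn (γ x) (γ₁ x) (γ₁ x)) x) ↔
    ∃ δ₁ : ℝ → ℝ × ℝ, ∀ x ∈ I, HasDerivAt δ (δ₁ x) x ∧ HasDerivAt δ₁ 0 x := by
  have hd1 : ∀ x ∈ I, ∀ γ', HasDerivAt γ γ' x → HasDerivAt δ (G (γ x) γ') x := by
    intro x hx γ' h
    refine ((hG _ (hmem x hx)).1.comp_hasDerivAt x h).congr_of_eventuallyEq ?_
    filter_upwards [hI.mem_nhds hx] with t ht using (hδ t ht).symm
  -- The second derivative of φ ∘ γ is G(Γ(γ', γ') + γ''). As G is injective, it vanishes exactly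
  -- when γ is a geodesic.
  have hd2 : ∀ x ∈ I, ∀ (γ₁ : ℝ → ℝ × ℝ) (γ₂ : ℝ × ℝ), HasDerivAt γ (γ₁ x) x →
      HasDerivAt γ₁ γ₂ x → HasDerivAt (fun x => G (γ x) (γ₁ x))
        (G (γ x) (B.conn (γ x) (γ₁ x) (γ₁ x) + γ₂)) x := by
    intro x hx γ₁ γ₂ h1 h2
    obtain ⟨-, -, h3, h4⟩ := hG _ (hmem x hx)
    refine ((h3.hasFDerivAt.comp_hasDerivAt x h1).clm_apply h2).congr_deriv ?_
    rw [h4, map_add]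
    rfl
  constructor
  · rintro ⟨γ₁, h⟩
    refine ⟨fun x => G (γ x) (γ₁ x), fun x hx => ⟨hd1 x hx _ (h x hx).1, ?_⟩⟩
    refine (hd2 x hx γ₁ _ (h x hx).1 (h x hx).2).congr_deriv ?_
    rw [add_neg_cancel, map_zero]
  · rintro ⟨δ₁, h⟩
    -- In this direction only δ is known to solve an equation; the existence of γ'' comes from the
    -- C² hypothesis.
    have hγ1 : ∀ x ∈ I, HasDerivAt γ (deriv γ x) x := fun x hx =>
      ((hγ.contDiffAt (hI.mem_nhds hx)).differentiableAt (by simp)).hasDerivAt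
    have hγ2 : ∀ x ∈ I, HasDerivAt (deriv γ) (deriv (deriv γ) x) x := fun x hx =>
      (((hγ.deriv_of_isOpen (m := 1) hI (by norm_num)).contDiffAt (hI.mem_nhds hx)).differentiableAt
        (by simp)).hasDerivAt
    refine ⟨deriv γ, fun x hx => ⟨hγ1 x hx, ?_⟩⟩
    have h1 : HasDerivAt (fun x => G (γ x) (deriv γ x)) 0 x := by
      refine (h x hx).2.congr_of_eventuallyEq ?_
      filter_upwards [hI.mem_nhds hx] with t ht using (hd1 t ht _ (hγ1 t ht)).unique (h t ht).1
    have h2 := (hd2 x hx _ _ (hγ1 x hx) (hγ2 x hx)).unique h1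
    have h3 := (hG _ (hmem x hx)).2.1 (h2.trans (map_zero _).symm)
    exact (hγ2 x hx).congr_deriv (eq_neg_of_add_eq_zero_right h3)

/-- Under the four conditions the system is linearizable, by a transformation that fixes the
independent variable. -/
theorem Coeffs.SmoothOn.linearizable_of_fourConditionsAt (hU : IsOpen U) (hB : B.SmoothOn U)
    (hflat : ∀ p ∈ U, B.FourConditionsAt p) : (B.system U).LinearizableToFreeParticle := by
  intro p hp
  obtain ⟨φ, hpφ, hφU, hφ, hφ', G, hG⟩ := hB.exists_flat_chart hU hflat (p₀ := p.2) hp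
  refine ⟨(OpenPartialHomeomorph.refl ℝ).prod φ, ⟨mem_univ _, hpφ⟩, ⟨?_, ?_⟩,
    fun q hq => hφU hq.2, subset_univ _, ?_⟩
  · exact contDiffOn_id.prodMap hφ
  · exact contDiffOn_id.prodMap hφ'
  intro I J y z v w hI _ hJ _ hy hz _ _ hsrc himg
  -- The transformation fixes x, so both graphs lie over the same interval and correspond pointwise
  -- under φ.
  have hfwd : ∀ x ∈ I, x ∈ J ∧ φ (y x, z x) = (v x, w x) := by
    intro x hx
    have h1 : (x, φ (y x, z x)) ∈ graphOver J v w := himg ▸ ⟨_, ⟨x, hx, rfl⟩, rfl⟩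
    obtain ⟨u, hu, h2⟩ := h1
    obtain ⟨rfl, h3⟩ := Prod.ext_iff.1 h2
    exact ⟨hu, h3.symm⟩
  have hIJ : I = J := by
    refine subset_antisymm (fun x hx => (hfwd x hx).1) fun u hu => ?_
    have h1 : (u, v u, w u) ∈ (OpenPartialHomeomorph.refl ℝ).prod φ '' graphOver I y z :=
      himg ▸ ⟨u, hu, rfl⟩
    obtain ⟨-, ⟨x, hx, rfl⟩, h2⟩ := h1
    have h3 : x = u := (Prod.ext_iff.1 h2).1
    rwa [← h3]
  subst hIJ
  have hmem : ∀ x ∈ I, (y x, z x) ∈ φ.source := fun x hx => (hsrc ⟨x, hx, rfl⟩).2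
  have h := geodesic_iff_of_flat_chart hG hI (γ := fun x => (y x, z x))
    (δ := fun x => (v x, w x)) (hy.prodMk hz) hmem fun x hx => (hfwd x hx).2
  rw [Coeffs.isSolutionOn_system_iff, isSolutionOn_freeParticle_iff, ← h]
  exact exists_congr fun γ₁ => forall₂_congr fun x hx =>
    ⟨fun h => h.2, fun h => ⟨hφU (hmem x hx), h⟩⟩

end

/-! ### Algebra of projective changes. -/

section Projective

variable {V : Type*} [NormedAddCommGroup V] [NormedSpace ℝ V]

/-- If the geodesics of a symmetric connection form `N` on `ℝ × V` are those of the product of the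
trivial connection on `ℝ` with `Γ` up to parametrization, then `N` differs from this product by a
projective change. The components along `V` are determined. -/
theorem projective_change_of_parallel {N : ℝ × V →L[ℝ] ℝ × V →L[ℝ] ℝ × V}
    {Γ : V →L[ℝ] V →L[ℝ] V} (hN : ∀ ξ η, N ξ η = N η ξ) (hΓ : ∀ v w, Γ v w = Γ w v)
    (h : ∀ ξ : ℝ × V, (N ξ ξ).1 • ξ.2 = ξ.1 • ((N ξ ξ).2 - Γ ξ.2 ξ.2)) (v w : V) :
    N (0, v) (0, w) = (0, Γ v w + (N (1, 0) (0, v)).1 • w + (N (1, 0) (0, w)).1 • v) ∧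
    (N (1, 0) (0, w)).2 = ((N (1, 0) (1, 0)).1 / 2) • w := by
  -- At ξ = (t, v) the hypothesis is a polynomial identity of degree at most three in t. Its lower
  -- coefficients are extracted in `diag` by interpolation at t = 0, 1, -1, 2.
  have key : ∀ (t : ℝ) (v : V),
      (t ^ 2 * (N (1, 0) (1, 0)).1 + 2 * t * (N (1, 0) (0, v)).1 + (N (0, v) (0, v)).1) • v =
      t • (t ^ 2 • (N (1, 0) (1, 0)).2 + (2 * t) • (N (1, 0) (0, v)).2 +
        (N (0, v) (0, v)).2 - Γ v v) := by
    intro t v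
    have h1 := h (t, v)
    have h2 : ((t, v) : ℝ × V) = t • (1, 0) + (0, v) := by simp
    have h3 : N (t, v) (t, v) = (t ^ 2) • N (1, 0) (1, 0) + (2 * t) • N (1, 0) (0, v) +
        N (0, v) (0, v) := by
      rw [h2]
      simp only [map_add, map_smul, add_apply, smul_apply]
      rw [hN (0, v) (1, 0)]
      module
    rw [h3] at h1
    simpa using h1
  have diag : ∀ v : V, (N (0, v) (0, v)).1 = 0 ∧
      (2 * (N (1, 0) (0, v)).1) • v = (N (0, v) (0, v)).2 - Γ v v ∧
      (N (1, 0) (1, 0)).1 • v = (2 : ℝ) • (N (1, 0) (0, v)).2 := by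
    intro v
    have k0 := key 0 v
    have k1 := key 1 v
    have k2 := key (-1) v
    have k3 := key 2 v
    refine ⟨?_, ?_, ?_⟩
    · rcases eq_or_ne v 0 with rfl | hv
      · simp [Prod.mk_zero_zero]
      · have : (N (0, v) (0, v)).1 • v = 0 := by
          linear_combination (norm := module) k0
        exact (smul_eq_zero.1 this).resolve_right hv
    · linear_combination (norm := module) k1 - (1 / 3 : ℝ) • k2 - (1 / 6 : ℝ) • k3 - (1 / 2 : ℝ) • k0
    · linear_combination (norm := module) (1 / 2 : ℝ) • k1 + (1 / 2 : ℝ) • k2 - k0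
  refine ⟨?_, ?_⟩
  -- Polarization of the diagonal identities.
  · have hvw : ((0, v + w) : ℝ × V) = (0, v) + (0, w) := by simp
    have d1 := diag v
    have d2 := diag w
    have d3 := diag (v + w)
    rw [hvw] at d3
    simp only [map_add, add_apply, Prod.fst_add, Prod.snd_add] at d3
    rw [hN (0, w) (0, v), hΓ w v] at d3
    ext1
    · simp only
      linarith [d1.1, d2.1, d3.1]
    · simp only
      linear_combination (norm := module) (1 / 2 : ℝ) • d1.2.1 + (1 / 2 : ℝ) • d2.2.1 -
        (1 / 2 : ℝ) • d3.2.1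
  · linear_combination (norm := module) (-1 / 2 : ℝ) • (diag w).2.2

/-- The algebraic step from the flatness of a connection on `ℝ × V` that is projectively equivalent
to the product connection of `Γ` to the flatness of `Γ`. -/
theorem curvature_eq_zero_of_projective_change {N : ℝ × V →L[ℝ] ℝ × V →L[ℝ] ℝ × V}
    {DN : ℝ × V →L[ℝ] ℝ × V →L[ℝ] ℝ × V →L[ℝ] ℝ × V} {Γ : V →L[ℝ] V →L[ℝ] V}
    {DΓ : V →L[ℝ] V →L[ℝ] V →L[ℝ] V} {a : ℝ}
    (hN : ∀ ξ η, N ξ η = N η ξ) (hΓ : ∀ v w, Γ v w = Γ w v)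
    (h0 : ∀ v w, N (0, v) (0, w) =
      (0, Γ v w + (N (1, 0) (0, v)).1 • w + (N (1, 0) (0, w)).1 • v))
    (h1 : ∀ w, (N (1, 0) (0, w)).2 = a • w)
    (hD : ∀ ζ v w, DN ζ (0, v) (0, w) =
      (0, DΓ ζ.2 v w + (DN ζ (1, 0) (0, v)).1 • w + (DN ζ (1, 0) (0, w)).1 • v))
    (hK : ∀ ζ ξ η, DN ζ ξ η + N ζ (N ξ η) = DN ξ ζ η + N ξ (N ζ η)) (u v x : V) :
    DΓ u v x + Γ u (Γ v x) = DΓ v u x + Γ v (Γ u x) := by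
  obtain ⟨μ, hμ⟩ : ∃ μ : V →L[ℝ] ℝ, ∀ v, (N (1, 0) (0, v)).1 = μ v :=
    ⟨(ContinuousLinearMap.fst ℝ ℝ V).comp ((N (1, 0)).comp (ContinuousLinearMap.inr ℝ ℝ V)),
      fun _ => rfl⟩
  have hx : ∀ w, N (1, 0) (0, w) = (μ w, a • w) := fun w => Prod.ext (hμ w) (h1 w)
  simp only [hμ] at h0
  -- This is the first component of flatness with one argument along x. With it the contributions of
  -- μ to the curvature cancel in the last step.
  have hm : ∀ u w, (DN (0, u) (1, 0) (0, w)).1 = μ (Γ u w) + μ u * μ w := by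
    intro u w
    have e1 := congrArg Prod.fst (hK (0, u) (1, 0) (0, w))
    have e2 : ((μ w, a • w) : ℝ × V) = μ w • (1, 0) + (0, a • w) := by simp
    rw [hx, h0, hx, hD, e2, map_add, map_smul, hN (0, u) (1, 0), hx, h0] at e1
    simp only [Prod.fst_add, Prod.smul_fst, smul_eq_mul, map_add, map_smul] at e1
    linear_combination e1
  have e := congrArg Prod.snd (hK (0, u) (0, v) (0, x))
  rw [h0, h0, h0, h0, hD, hD, hm, hm, hm, hm] at e
  simp only [Prod.snd_add, map_add, map_smul, smul_eq_mul] at e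
  rw [hΓ v u] at e
  linear_combination (norm := module) e

end Projective

/-! ### Preimages of straight lines. -/

section

variable {U : Set (ℝ × ℝ)} {B : Coeffs}

/-- A curve `c` in `(x, y, z)`-space whose `x`-component is locally invertible can be written locally
as a graph over an open interval of the `x`-axis. -/
theorem exists_graph_reparametrization {c c₁ : ℝ → ℝ × ℝ × ℝ} {T : Set ℝ} (hT : T ∈ 𝓝 0)
    (hc : ∀ s ∈ T, ContDiffAt ℝ ∞ c s) (hc₁ : ∀ s ∈ T, HasDerivAt c (c₁ s) s)
    (hcont : ContinuousAt c₁ 0) (h0 : (c₁ 0).1 ≠ 0) :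
    ∃ (ε : ℝ) (y z : ℝ → ℝ), 0 < ε ∧ ball 0 ε ⊆ T ∧
      IsOpen ((fun s => (c s).1) '' ball 0 ε) ∧ ContDiffOn ℝ 2 y ((fun s => (c s).1) '' ball 0 ε) ∧
      ContDiffOn ℝ 2 z ((fun s => (c s).1) '' ball 0 ε) ∧
      ∀ s ∈ ball (0 : ℝ) ε, (y (c s).1, z (c s).1) = (c s).2 := by
  have h0T : (0 : ℝ) ∈ T := mem_of_mem_nhds hT
  have hX : ∀ s ∈ T, ContDiffAt ℝ ∞ (fun s => (c s).1) s := fun s hs => (hc s hs).fst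
  have hX' : ∀ s ∈ T, HasDerivAt (fun s => (c s).1) (c₁ s).1 s := fun s hs => (hc₁ s hs).prodFst
  set e := (hX 0 h0T).toOpenPartialHomeomorph _ ((hX' 0 h0T).hasFDerivAt_equiv h0) (by simp)
  have he : ∀ s, e s = (c s).1 := fun _ => rfl
  have hes : e.source ∈ 𝓝 0 := e.open_source.mem_nhds
    ((hX 0 h0T).mem_toOpenPartialHomeomorph_source ((hX' 0 h0T).hasFDerivAt_equiv h0) (by simp))
  have hne : ∀ᶠ s in 𝓝 (0 : ℝ), (c₁ s).1 ≠ 0 := hcont.fst.eventually_ne h0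
  obtain ⟨ε, hε, hball⟩ := Metric.eventually_nhds_iff_ball.1
    ((eventually_mem_set.2 hT).and ((eventually_mem_set.2 hes).and hne))
  have hσ : ∀ s ∈ ball (0 : ℝ) ε, ContDiffAt ℝ ∞ (fun x => c (e.symm x)) (c s).1 := by
    intro s hs
    obtain ⟨h1, h2, h3⟩ := hball s hs
    have h4 : e.symm (c s).1 = s := e.left_inv h2
    have h5 : ContDiffAt ℝ ∞ e.symm (c s).1 := by
      refine e.contDiffAt_symm_deriv h3 (e.map_source h2) ?_ ?_
      · rw [h4]
        exact hX' s h1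
      · rw [h4]
        exact hX s h1
    refine ContDiffAt.comp _ ?_ h5
    rw [h4]
    exact hc s h1
  refine ⟨ε, fun x => (c (e.symm x)).2.1, fun x => (c (e.symm x)).2.2, hε,
    fun s hs => (hball s hs).1, ?_, ?_, ?_, ?_⟩
  · exact e.isOpen_image_of_subset_source isOpen_ball fun s hs => (hball s hs).2.1
  · rintro - ⟨s, hs, rfl⟩
    exact ((hσ s hs).of_le (by norm_cast)).snd.fst.contDiffWithinAt
  · rintro - ⟨s, hs, rfl⟩
    exact ((hσ s hs).of_le (by norm_cast)).snd.snd.contDiffWithinAt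
  · intro s hs
    have h4 : e.symm (c s).1 = s := e.left_inv (hball s hs).2.1
    simp only [h4]

/-- If the graph of a solution of the system is parametrized by a curve `c`, then `c` satisfies the
geodesic equation up to a multiple of `c'`. -/
theorem Coeffs.parallel_of_isSolutionOn {c c₁ : ℝ → ℝ × ℝ × ℝ} {κ : ℝ × ℝ × ℝ} {W : Set ℝ}
    (hW : W ∈ 𝓝 0) (hc₁ : ∀ s ∈ W, HasDerivAt c (c₁ s) s) (hκ : HasDerivAt c₁ κ 0)
    {y z : ℝ → ℝ} (hyz : ∀ s ∈ W, (y (c s).1, z (c s).1) = (c s).2)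
    (hsol : (B.system U).IsSolutionOn ((fun s => (c s).1) '' W) y z) :
    (c₁ 0).1 • κ.2 = κ.1 • (c₁ 0).2 - (c₁ 0).1 • B.conn (c 0).2 (c₁ 0).2 (c₁ 0).2 := by
  obtain ⟨γ₁, hγ⟩ := Coeffs.isSolutionOn_system_iff.1 hsol
  have h0W : (0 : ℝ) ∈ W := mem_of_mem_nhds hW
  have hX' : ∀ s ∈ W, HasDerivAt (fun s => (c s).1) (c₁ s).1 s := fun s hs => (hc₁ s hs).prodFst
  have h1 : ∀ s ∈ interior W, (c₁ s).2 = (c₁ s).1 • γ₁ (c s).1 := by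
    intro s hs
    have hsW := interior_subset hs
    refine (hc₁ s hsW).prodSnd.unique ?_
    refine HasDerivAt.congr_of_eventuallyEq
      (HasDerivAt.scomp s (hγ _ ⟨s, hsW, rfl⟩).2.1 (hX' s hsW)) ?_
    filter_upwards [isOpen_interior.mem_nhds hs] with t ht
    exact (hyz t (interior_subset ht)).symm
  -- Differentiating c₁.2 = c₁.1 • γ₁ at 0 brings in the equation for γ₁; multiplying by (c₁ 0).1
  -- then eliminates γ₁ without a division.
  have h2 := hκ.prodFst.smul
    (HasDerivAt.scomp (0 : ℝ) (hγ _ ⟨0, h0W, rfl⟩).2.2 (hX' 0 h0W))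
  replace h2 := h2.congr_of_eventuallyEq (f₁ := fun s => (c₁ s).2) (by
    filter_upwards [interior_mem_nhds.2 hW] with t ht using h1 t ht)
  have h3 := hκ.prodSnd.unique h2
  have h4 := h1 0 (mem_interior_iff_mem_nhds.2 hW)
  rw [hyz 0 h0W] at h3
  rw [h3, h4]
  simp only [Function.comp_apply, map_smul, smul_apply]
  module

/-- A point transformation of the system into the free-particle system pulls straight lines back to
geodesics, up to parametrization. -/
theorem Coeffs.parallel_of_transforms {Φ : OpenPartialHomeomorph (ℝ × ℝ × ℝ) (ℝ × ℝ × ℝ)}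
    (hΦ : IsPointTransformation Φ) (hT : Transforms Φ (B.system U) freeParticle)
    {q d : ℝ × ℝ × ℝ} (hq : q ∈ Φ.target) (hd : d.1 ≠ 0) (hξ : (fderiv ℝ Φ.symm q d).1 ≠ 0) :
    (fderiv ℝ Φ.symm q d).1 • (fderiv ℝ (fderiv ℝ Φ.symm) q d d).2 =
      (fderiv ℝ (fderiv ℝ Φ.symm) q d d).1 • (fderiv ℝ Φ.symm q d).2 -
      (fderiv ℝ Φ.symm q d).1 •
        B.conn (Φ.symm q).2 (fderiv ℝ Φ.symm q d).2 (fderiv ℝ Φ.symm q d).2 := by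
  -- The line q + s • d is a graph over u because d.1 ≠ 0, and its preimage c is locally a graph
  -- over x by `hξ`. Hence `hT` applies to this pair.
  set c : ℝ → ℝ × ℝ × ℝ := fun s => Φ.symm (q + s • d) with hcdef
  set c₁ : ℝ → ℝ × ℝ × ℝ := fun s => fderiv ℝ Φ.symm (q + s • d) d with hc₁def
  have hline : ∀ s : ℝ, HasDerivAt (fun s : ℝ => q + s • d) d s := fun s => by
    simpa using ((hasDerivAt_id s).smul_const d).const_add q
  have hlc : Continuous fun s : ℝ => q + s • d := by fun_prop
  set T : Set ℝ := (fun s : ℝ => q + s • d) ⁻¹' Φ.target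
  have hTn : T ∈ 𝓝 0 := (Φ.open_target.preimage hlc).mem_nhds (by simpa [T] using hq)
  have hΨ : ∀ q ∈ Φ.target, ContDiffAt ℝ ∞ Φ.symm q := fun q hq =>
    hΦ.2.contDiffAt (Φ.open_target.mem_nhds hq)
  have hc : ∀ s ∈ T, ContDiffAt ℝ ∞ c s := fun s hs =>
    ContDiffAt.comp s (hΨ _ hs) (by fun_prop)
  have hc₁ : ∀ s ∈ T, HasDerivAt c (c₁ s) s := fun s hs =>
    ((hΨ _ hs).differentiableAt (by simp)).hasFDerivAt.comp_hasDerivAt s (hline s)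
  have hκ : HasDerivAt c₁ (fderiv ℝ (fderiv ℝ Φ.symm) q d d) 0 := by
    have h1 : HasFDerivAt (fderiv ℝ Φ.symm) (fderiv ℝ (fderiv ℝ Φ.symm) q) (q + (0 : ℝ) • d) := by
      rw [zero_smul, add_zero]
      exact (((hΨ q hq).fderiv_right (m := 1) (by norm_cast)).differentiableAt
        (by simp)).hasFDerivAt
    have h2 := h1.comp_hasDerivAt (0 : ℝ) (hline 0)
    exact (h2.clm_apply (hasDerivAt_const (0 : ℝ) d)).congr_deriv (by simp)
  have h00 : c₁ 0 = fderiv ℝ Φ.symm q d := by simp [hc₁def]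
  have hc0 : c 0 = Φ.symm q := by simp [hcdef]
  obtain ⟨ε, y, z, hε, hεT, hI, hy, hz, hyz⟩ := exists_graph_reparametrization hTn hc hc₁
    hκ.continuousAt (by rwa [h00])
  set W := ball (0 : ℝ) ε
  set J : Set ℝ := (fun s => q.1 + s * d.1) '' W
  have hpre : IsPreconnected W := (convex_ball (0 : ℝ) ε).isPreconnected
  have hJo : IsOpen J :=
    ((Homeomorph.mulRight₀ d.1 hd).trans (Homeomorph.addLeft q.1)).isOpenMap W isOpen_ball
  have hJc : J.OrdConnected := (hpre.image _ (by fun_prop)).ordConnected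
  have hIc : ((fun s => (c s).1) '' W).OrdConnected :=
    (hpre.image _ fun s hs =>
      (hc s (hεT hs)).continuousAt.fst.continuousWithinAt).ordConnected
  have hgraph : graphOver ((fun s => (c s).1) '' W) y z = c '' W := by
    rw [graphOver, image_image]
    exact image_congr fun s hs => Prod.ext rfl (hyz s hs)
  set v : ℝ → ℝ := fun u => q.2.1 + (u - q.1) / d.1 * d.2.1
  set w : ℝ → ℝ := fun u => q.2.2 + (u - q.1) / d.1 * d.2.2
  have haff : ∀ k l u : ℝ, HasDerivAt (fun u => k + (u - q.1) / d.1 * l) (l / d.1) u := by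
    intro k l u
    exact ((((hasDerivAt_id u).sub_const q.1).div_const d.1).mul_const l |>.const_add k).congr_deriv
      (by ring)
  have himg : Φ '' graphOver ((fun s => (c s).1) '' W) y z = graphOver J v w := by
    rw [hgraph, image_image, graphOver, image_image]
    refine image_congr fun s hs => ?_
    have h1 : Φ (c s) = q + s • d := Φ.right_inv (hεT hs)
    rw [h1]
    ext <;> simp [v, w, hd]
  have hsrc : graphOver ((fun s => (c s).1) '' W) y z ⊆ Φ.source := by
    rw [hgraph]
    rintro - ⟨s, hs, rfl⟩
    exact Φ.map_target (hεT hs)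
  have hfree : freeParticle.IsSolutionOn J v w :=
    ⟨fun _ => d.2.1 / d.1, fun _ => d.2.2 / d.1, fun u _ =>
      ⟨mem_univ _, haff _ _ u, haff _ _ u, hasDerivAt_const _ _, hasDerivAt_const _ _⟩⟩
  have hsol := (hT.2.2 _ J y z v w hI hIc hJo hJc hy hz (by fun_prop) (by fun_prop) hsrc himg).2
    hfree
  have := Coeffs.parallel_of_isSolutionOn (ball_mem_nhds 0 hε) (fun s hs => hc₁ s (hεT hs)) hκ
    hyz hsol
  rwa [h00, hc0] at this

end

/-! ### Differentiation along lines, and the pulled-back flat connection. -/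

theorem hasDerivAt_line_apply {E F K : Type*} [NormedAddCommGroup E] [NormedSpace ℝ E]
    [NormedAddCommGroup F] [NormedSpace ℝ F] [NormedAddCommGroup K] [NormedSpace ℝ K]
    {A : E → F →L[ℝ] K} {p : E} (hA : DifferentiableAt ℝ A p) (ζ : E) {f : ℝ → F} {f' : F}
    (hf : HasDerivAt f f' 0) :
    HasDerivAt (fun t : ℝ => A (p + t • ζ) (f t)) (fderiv ℝ A p ζ (f 0) + A p f') 0 := by
  have h0 : HasDerivAt (fun t : ℝ => p + t • ζ) ζ 0 := by
    simpa using ((hasDerivAt_id (0 : ℝ)).smul_const ζ).const_add p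
  have h1 : HasFDerivAt A (fderiv ℝ A p) (p + (0 : ℝ) • ζ) := by
    simpa using hA.hasFDerivAt
  have h2 : HasDerivAt (fun t : ℝ => A (p + t • ζ)) (fderiv ℝ A p ζ) 0 :=
    h1.comp_hasDerivAt (0 : ℝ) h0
  have h3 := h2.clm_apply hf
  rw [zero_smul, add_zero] at h3
  exact h3

/-- Combined with uniqueness of derivatives, this differentiates in direction ζ an identity between
multilinear expressions that holds near p. -/
theorem hasDerivAt_line_apply₂ {E F F' K : Type*} [NormedAddCommGroup E] [NormedSpace ℝ E]
    [NormedAddCommGroup F] [NormedSpace ℝ F] [NormedAddCommGroup F'] [NormedSpace ℝ F']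
    [NormedAddCommGroup K] [NormedSpace ℝ K]
    {A : E → F →L[ℝ] F' →L[ℝ] K} {p : E} (hA : DifferentiableAt ℝ A p) (ζ : E) (ξ : F) (η : F') :
    HasDerivAt (fun t : ℝ => A (p + t • ζ) ξ η) (fderiv ℝ A p ζ ξ η) 0 := by
  have h := hasDerivAt_line_apply hA ζ (hasDerivAt_const (0 : ℝ) ξ)
  exact (h.clm_apply (hasDerivAt_const (0 : ℝ) η)).congr_deriv (by simp)

/-- The kernel is a proper subspace, so it has empty interior. -/
theorem dense_setOf_apply_ne_zero {E : Type*} [NormedAddCommGroup E] [NormedSpace ℝ E]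
    {f : E →L[ℝ] ℝ} {w : E} (hw : f w ≠ 0) : Dense {ξ | f ξ ≠ 0} := by
  have h : interior (LinearMap.ker f.toLinearMap : Set E) = ∅ := by
    by_contra hne
    have h1 := Submodule.eq_top_of_nonempty_interior' _ (nonempty_iff_ne_empty.2 hne)
    exact hw (LinearMap.mem_ker.1 (h1 ▸ Submodule.mem_top : w ∈ LinearMap.ker f.toLinearMap))
  exact interior_eq_empty_iff_dense_compl.1 h

section PulledBack

variable {E : Type*} [NormedAddCommGroup E] [NormedSpace ℝ E]
  {Φ : OpenPartialHomeomorph E E}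

/-- The pull-back under `Φ` of the flat connection: `N (ξ, η) = DΦ⁻¹ D²Φ (ξ, η)`. -/
noncomputable def pullbackConn (Φ : OpenPartialHomeomorph E E) (p : E) : E →L[ℝ] E →L[ℝ] E :=
  (ContinuousLinearMap.compL ℝ E E E (fderiv ℝ Φ.symm (Φ p))).comp (fderiv ℝ (fderiv ℝ Φ) p)

theorem pullbackConn_apply (p ξ η : E) : pullbackConn Φ p ξ η =
    fderiv ℝ Φ.symm (Φ p) (fderiv ℝ (fderiv ℝ Φ) p ξ η) := rfl

variable (h₁ : ContDiffOn ℝ ∞ Φ Φ.source) (h₂ : ContDiffOn ℝ ∞ Φ.symm Φ.target) {p : E}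
  (hp : p ∈ Φ.source)

include h₁ h₂ hp

theorem fderiv_symm_fderiv_apply (ξ : E) : fderiv ℝ Φ.symm (Φ p) (fderiv ℝ Φ p ξ) = ξ := by
  have e1 := ((h₁.contDiffAt (Φ.open_source.mem_nhds hp)).differentiableAt (by simp)).hasFDerivAt
  have e2 := ((h₂.contDiffAt (Φ.open_target.mem_nhds (Φ.map_source hp))).differentiableAt
    (by simp)).hasFDerivAt
  have e3 := (e2.comp p e1).congr_of_eventuallyEq (f₁ := id) (by
    filter_upwards [Φ.open_source.mem_nhds hp] with q hq using (Φ.left_inv hq).symm)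
  exact (DFunLike.congr_fun (e3.unique (hasFDerivAt_id p)) ξ)

theorem fderiv_fderiv_symm_apply (d : E) : fderiv ℝ Φ p (fderiv ℝ Φ.symm (Φ p) d) = d := by
  have := fderiv_symm_fderiv_apply (Φ := Φ.symm) h₂ h₁ (Φ.map_source hp) d
  rwa [Φ.symm_symm, Φ.left_inv hp] at this

theorem fderiv_pullbackConn_apply (ξ η : E) :
    fderiv ℝ Φ p (pullbackConn Φ p ξ η) = fderiv ℝ (fderiv ℝ Φ) p ξ η :=
  fderiv_fderiv_symm_apply h₁ h₂ hp _

omit h₂ in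
theorem contDiffAt_fderiv_of_mem_source : ContDiffAt ℝ ∞ (fderiv ℝ Φ) p :=
  (h₁.contDiffAt (Φ.open_source.mem_nhds hp)).fderiv_right (by norm_cast)

omit h₂ in
theorem pullbackConn_symm (ξ η : E) : pullbackConn Φ p ξ η = pullbackConn Φ p η ξ := by
  have := (h₁.contDiffAt (Φ.open_source.mem_nhds hp)).isSymmSndFDerivAt
    (by rw [minSmoothness_of_isRCLikeNormedField]; norm_cast)
  rw [pullbackConn_apply, pullbackConn_apply, this.eq]

theorem differentiableAt_pullbackConn : DifferentiableAt ℝ (pullbackConn Φ) p := by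
  have e1 : ContDiffAt ℝ ∞ (fderiv ℝ (fderiv ℝ Φ)) p :=
    (contDiffAt_fderiv_of_mem_source h₁ hp).fderiv_right (by norm_cast)
  have e2 : ContDiffAt ℝ ∞ (fderiv ℝ Φ.symm) (Φ p) :=
    contDiffAt_fderiv_of_mem_source (Φ := Φ.symm) h₂ (Φ.map_source hp)
  have e3 := e2.comp p (h₁.contDiffAt (Φ.open_source.mem_nhds hp))
  exact ((((ContinuousLinearMap.contDiff _).contDiffAt.comp p e3).clm_comp e1).differentiableAt
    (by simp))

/-- Differentiating DΦ(N(ξ, η)) = D²Φ(ξ, η) in direction ζ shows that DΦ sends the left side to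
D³Φ(ζ, ξ, η). This is symmetric in ζ, ξ, and DΦ is injective. -/
theorem curvature_pullbackConn (ζ ξ η : E) :
    fderiv ℝ (pullbackConn Φ) p ζ ξ η + pullbackConn Φ p ζ (pullbackConn Φ p ξ η) =
      fderiv ℝ (pullbackConn Φ) p ξ ζ η + pullbackConn Φ p ξ (pullbackConn Φ p ζ η) := by
  have hG := contDiffAt_fderiv_of_mem_source h₁ hp
  have key : ∀ ζ ξ η, fderiv ℝ Φ p (fderiv ℝ (pullbackConn Φ) p ζ ξ η +
      pullbackConn Φ p ζ (pullbackConn Φ p ξ η)) =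
      fderiv ℝ (fderiv ℝ (fderiv ℝ Φ)) p ζ ξ η := by
    intro ζ ξ η
    have e1 := hasDerivAt_line_apply (hG.differentiableAt (by simp)) ζ
      (hasDerivAt_line_apply₂ (differentiableAt_pullbackConn h₁ h₂ hp) ζ ξ η)
    have e2 := hasDerivAt_line_apply₂
      ((hG.fderiv_right (m := ∞) (by norm_cast)).differentiableAt (by simp)) ζ ξ η
    have hc : ContinuousAt (fun t : ℝ => p + t • ζ) 0 := by fun_prop
    have e3 := e1.unique (e2.congr_of_eventuallyEq (by
      filter_upwards [hc.eventually_mem (Φ.open_source.mem_nhds (by simpa using hp))] with t ht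
        using fderiv_pullbackConn_apply h₁ h₂ ht ξ η))
    rw [← e3, map_add, fderiv_pullbackConn_apply h₁ h₂ hp, add_comm, zero_smul, add_zero]
  have hsymm := hG.isSymmSndFDerivAt
    (by rw [minSmoothness_of_isRCLikeNormedField]; norm_cast)
  have h := (key ζ ξ η).trans ((congrArg (fun A => A η) (hsymm.eq ζ ξ)).trans (key ξ ζ η).symm)
  have := congrArg (fderiv ℝ Φ.symm (Φ p)) h
  rwa [fderiv_symm_fderiv_apply h₁ h₂ hp, fderiv_symm_fderiv_apply h₁ h₂ hp] at this

/-- Differentiate DΦ⁻¹(Φ) DΦ ξ = ξ in direction ξ. This translates second derivatives of preimages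
of lines into N. -/
theorem fderiv_fderiv_symm_eq_neg_pullbackConn (ξ : E) :
    fderiv ℝ (fderiv ℝ Φ.symm) (Φ p) (fderiv ℝ Φ p ξ) (fderiv ℝ Φ p ξ) =
      -pullbackConn Φ p ξ ξ := by
  have hΦ := (h₁.contDiffAt (Φ.open_source.mem_nhds hp)).differentiableAt (by simp)
  have hH : ContDiffAt ℝ ∞ (fderiv ℝ Φ.symm) (Φ p) :=
    contDiffAt_fderiv_of_mem_source (Φ := Φ.symm) h₂ (Φ.map_source hp)
  have hH' := (hH.differentiableAt (by simp)).hasFDerivAt.comp p hΦ.hasFDerivAt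
  have e1 := hasDerivAt_line_apply hH'.differentiableAt ξ
    (hasDerivAt_line_apply ((contDiffAt_fderiv_of_mem_source h₁ hp).differentiableAt (by simp)) ξ
      (hasDerivAt_const (0 : ℝ) ξ))
  have hc : ContinuousAt (fun t : ℝ => p + t • ξ) 0 := by fun_prop
  have e2 := e1.unique ((hasDerivAt_const (0 : ℝ) ξ).congr_of_eventuallyEq (by
    filter_upwards [hc.eventually_mem (Φ.open_source.mem_nhds (by simpa using hp))] with t ht
      using fderiv_symm_fderiv_apply h₁ h₂ ht ξ))
  rw [hH'.fderiv] at e2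
  simp only [zero_smul, add_zero, map_zero, ContinuousLinearMap.comp_apply] at e2
  exact eq_neg_of_add_eq_zero_left e2

end PulledBack

/-! ### Necessity: linearizability forces flatness. -/

section

variable {U : Set (ℝ × ℝ)} {B : Coeffs}

/-- The geodesics of the pulled-back flat connection are the solutions of the system. -/
theorem Coeffs.parallel_pullbackConn {Φ : OpenPartialHomeomorph (ℝ × ℝ × ℝ) (ℝ × ℝ × ℝ)}
    (hΦ : IsPointTransformation Φ) (hT : Transforms Φ (B.system U) freeParticle)
    {p : ℝ × ℝ × ℝ} (hp : p ∈ Φ.source) (ξ : ℝ × ℝ × ℝ) :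
    (pullbackConn Φ p ξ ξ).1 • ξ.2 =
      ξ.1 • ((pullbackConn Φ p ξ ξ).2 - B.conn p.2 ξ.2 ξ.2) := by
  set f := (ContinuousLinearMap.fst ℝ ℝ (ℝ × ℝ)).comp (fderiv ℝ Φ p) with hf
  -- The comparison of curves needs directions along which neither x nor u is stationary. These are
  -- dense, and the identity is closed in ξ, so it extends to every direction.
  have hd1 : Dense {ξ : ℝ × ℝ × ℝ | ContinuousLinearMap.fst ℝ ℝ (ℝ × ℝ) ξ ≠ 0} :=
    dense_setOf_apply_ne_zero (w := (1, 0)) (by simp)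
  have hd2 : Dense {ξ : ℝ × ℝ × ℝ | f ξ ≠ 0} := by
    refine dense_setOf_apply_ne_zero (w := fderiv ℝ Φ.symm (Φ p) (1, 0)) ?_
    rw [hf, ContinuousLinearMap.comp_apply, fderiv_fderiv_symm_apply hΦ.1 hΦ.2 hp]
    simp
  have ho : IsOpen {ξ : ℝ × ℝ × ℝ | f ξ ≠ 0} := isOpen_ne_fun f.continuous continuous_const
  have hcl : IsClosed {ξ : ℝ × ℝ × ℝ | (pullbackConn Φ p ξ ξ).1 • ξ.2 =
      ξ.1 • ((pullbackConn Φ p ξ ξ).2 - B.conn p.2 ξ.2 ξ.2)} :=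
    isClosed_eq (by fun_prop) (by fun_prop)
  have hsub : {ξ : ℝ × ℝ × ℝ | ContinuousLinearMap.fst ℝ ℝ (ℝ × ℝ) ξ ≠ 0} ∩ {ξ | f ξ ≠ 0} ⊆
      {ξ : ℝ × ℝ × ℝ | (pullbackConn Φ p ξ ξ).1 • ξ.2 =
        ξ.1 • ((pullbackConn Φ p ξ ξ).2 - B.conn p.2 ξ.2 ξ.2)} := by
    rintro η ⟨h1, h2⟩
    have e := fderiv_symm_fderiv_apply hΦ.1 hΦ.2 hp η
    have h := Coeffs.parallel_of_transforms hΦ hT (Φ.map_source hp) (d := fderiv ℝ Φ p η) h2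
      (by rw [e]; exact h1)
    rw [fderiv_fderiv_symm_eq_neg_pullbackConn hΦ.1 hΦ.2 hp, e, Φ.left_inv hp] at h
    simp only [Prod.fst_neg, Prod.snd_neg] at h
    simp only [mem_ofPred_eq]
    linear_combination (norm := module) h
  exact closure_minimal hsub hcl ((hd1.inter_of_isOpen_right hd2 ho) ξ)

/-- A linearizable system satisfies the four conditions. -/
theorem Coeffs.SmoothOn.fourConditionsAt_of_linearizable (hU : IsOpen U) (hB : B.SmoothOn U)
    (hL : (B.system U).LinearizableToFreeParticle) {p : ℝ × ℝ} (hp : p ∈ U) :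
    B.FourConditionsAt p := by
  -- The system is autonomous, so x = 0 is an arbitrary choice.
  obtain ⟨Φ, hpΦ, hΦ, hT⟩ := hL (0, p) hp
  have hN : ∀ q ∈ Φ.source, ∀ v w, _ := fun q hq v w =>
    projective_change_of_parallel (Γ := B.conn q.2) (pullbackConn_symm hΦ.1 hq) B.conn_symm
      (Coeffs.parallel_pullbackConn hΦ hT hq) v w
  have hconn : HasFDerivAt (fun q : ℝ × ℝ × ℝ => B.conn q.2)
      ((fderiv ℝ B.conn p).comp (ContinuousLinearMap.snd ℝ ℝ (ℝ × ℝ))) (0, p) := by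
    have h1 : HasFDerivAt B.conn (fderiv ℝ B.conn p) ((0 : ℝ), p).2 :=
      ((hB.conn.contDiffAt (hU.mem_nhds hp)).differentiableAt (by simp)).hasFDerivAt
    exact h1.comp ((0 : ℝ), p) hasFDerivAt_snd
  have hdN := differentiableAt_pullbackConn hΦ.1 hΦ.2 hpΦ
  refine (hB.fourConditionsAt_iff_curvature_eq_zero hU hp).2
    (curvature_eq_zero_of_projective_change (N := pullbackConn Φ (0, p))
      (pullbackConn_symm hΦ.1 hpΦ) B.conn_symm (fun v w => (hN _ hpΦ v w).1)
      (fun w => (hN _ hpΦ 0 w).2) ?_ (curvature_pullbackConn hΦ.1 hΦ.2 hpΦ))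
  -- The form of N found in `hN` holds on the whole source, so it may be differentiated at (0, p). Γ
  -- does not depend on x, hence only ζ.2 enters its derivative.
  intro ζ v w
  have e1 := hasDerivAt_line_apply₂ hdN ζ (0, v) (0, w)
  have e2 := (hasDerivAt_line_apply₂ hdN ζ (1, 0) (0, v)).prodFst.smul_const w
  have e3 := (hasDerivAt_line_apply₂ hdN ζ (1, 0) (0, w)).prodFst.smul_const v
  have e4 := ((hasDerivAt_line_apply₂ hconn.differentiableAt ζ v w).add e2).add e3
  have hc : ContinuousAt (fun t : ℝ => ((0 : ℝ), p) + t • ζ) 0 := by fun_prop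
  have e5 := e1.unique (((hasDerivAt_const (0 : ℝ) (0 : ℝ)).prodMk e4).congr_of_eventuallyEq (by
    filter_upwards [hc.eventually_mem (Φ.open_source.mem_nhds (by simpa using hpΦ))] with t ht
      using (hN _ ht v w).1))
  rw [e5, hconn.fderiv]
  rfl

end

end QuadLin

theorem corollary1 (U : Set (ℝ × ℝ)) (hU : IsOpen U) (B : QuadLin.Coeffs) (hB : B.SmoothOn U) :
    ((B.system U).LinearizableToFreeParticle ↔ ∀ p ∈ U, B.FourConditionsAt p) ∧
    (∀ p ∈ U, B.FourConditionsAt p ↔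
      QuadLin.FlatnessConditionsAt
        (-B.B222) (-B.B223) (-B.B233) (-B.B322) (-B.B323) (-B.B333) p) ∧
    (∀ p ∈ U, B.FourConditionsAt p ↔ ∀ i j k l : Fin 2, B.riemann i j k l p = 0) := by
  exact ⟨⟨fun h _ hp => hB.fourConditionsAt_of_linearizable hU h hp,
      hB.linearizable_of_fourConditionsAt hU⟩,
    fun _ hp => QuadLin.Coeffs.fourConditionsAt_iff_flatnessConditionsAt hU hB hp,
    fun _ _ => QuadLin.Coeffs.fourConditionsAt_iff_riemann_eq_zero⟩
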